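/- **Setting.** Let $L\ge 1$. Let $Y_0,Y_1,V,\Theta$ be real random variables, $Z,\Gamma$ random vectors in $\mathbb R^{L-1}$, and put $\Delta=Y_1-Y_0$, $D=\mathbf 1\{V-Z'\Gamma-\Theta>0\}$, $Y=Y_0+\Delta D$. Let $X_0,X_1$ be random vectors in $\mathbb R^k$ and $X=X_D$. Put $$\widetilde S=\frac{(Z',1)'}{\|(Z',1)\|}\in\mathbb S^{L-1},\qquad \widetilde V=\frac{V}{\|(Z',1)\|},\qquad \widetilde\Gamma=(\Gamma',\Theta)'\in\mathbb R^L,$$ so that $D=\mathbf 1\{\widetilde S'\widetilde\Gamma<\widetilde V\}$, and let $H^+=\{s\in\mathbb S^{L-1}:s_L>0\}$. Fix a regular conditional distribution of $(Y_0,Y_1,V,Z,\Gamma,\Theta)$ given $X$; everything below that is conditional on $X=x$ refers to it. **Assumption 1.** For almost every $x$ (with respect to the law of $X$): (i) given $X=x$, the law of $(\widetilde S,\widetilde V,\widetilde\Gamma)$ is absolutely continuous with respect to the product of the spherical measure on $\mathbb S^{L-1}$ and Lebesgue measure on $\mathbb R^{L+1}$; (ii) given $X=x$, $(V,Z)$ is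 independent of $(Y_0,\Gamma,\Theta)$ and is independent of $(Y_1,\Gamma,\Theta)$; (iii) $0<\mathbb P(D=1\mid X=x)<1$. Moreover, (iv) $X_0=X_1$ almost surely. **Assumption 2.** For almost every $x$: if $L=1$, then given $X=x$ the support of $V$ contains the support of $\Theta$; if $L\ge2$, then given $X=x$ the support of $\widetilde S$ is $\overline{H^+}$ and, for almost every $s$, the support of $\widetilde V$ given $\widetilde S=s$, $X=x$ contains $\big[\inf_\gamma s'\gamma,\ \sup_\gamma s'\gamma\big]$, where $\gamma$ runs over the support of $\widetilde\Gamma$ given $X=x$ (the bounds may be infinite). **Notation.** For $f\in L^1(\mathbb R^L)$, $s\in\mathbb S^{L-1}$, $u\in\mathbb R$, the Radon transform is $R[f](s,u)=\int_{\{\gamma:\gamma's=u\}}f$, the integral with respect to $(L-1)$-dimensional Lebesgue measure on the hyperplane (for $L=1$ it is the value of $f$ at the point $us$). $R^{-1}[g]$ is the $f\in L^1(\mathbb R^L)$, unique up to null sets, with $R[f]=g$ almost everywhere on $H^+\times\mathbb R$. For a random variable $W$, let $(s,v)\mapsto\mathbb E[W\mid(\widetilde S,\widetilde V)=(s,v),X=x]$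 be the continuous version of the regression function on its domain, the support of $(\widetilde S,\widetilde V)$ given $X=x$; take its derivative in $v$ within this domain, extend the derivative by $0$ outside, and write $$I_x[W]=R^{-1}\Big[\,\overline{\partial_v\,\mathbb E\big[W\mid(\widetilde S,\widetilde V)=\cdot,\,X=x\big]}\,\Big]:\mathbb R^L\to\mathbb R .$$ In suprema and infima over $y$, the versions of $I_x[\mathbf 1\{Y\le y\}D](\gamma)$ and $I_x[\mathbf 1\{Y\le y\}(D-1)](\gamma)$ that are right-continuous in $y$ are used. Define $$F^L(y_0,y_1|x)=\max\Big\{\int_{\mathbb R^L} I_x\big[\mathbf 1\{Y\le y_1\}D+\mathbf 1\{Y\le y_0\}(D-1)\big](\gamma)\,d\gamma-1,\ 0\Big\},$$ $$F^U(y_0,y_1|x)=\min\Big\{\int_{\mathbb R^L} I_x[\mathbf 1\{Y\le y_0\}(D-1)](\gamma)\,d\gamma,\ \int_{\mathbb R^L} I_x[\mathbf 1\{Y\le y_1\}D](\gamma)\,d\gamma\Big\},$$ $$F^L(\delta|x)=\int_{\mathbb R^L}\sup_{y\in\mathbb R}\max\big\{I_x[\mathbf 1\{Y\le y\}D](\gamma)-I_x[\mathbf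 1\{Y\le y-\delta\}(D-1)](\gamma),\ 0\big\}\,d\gamma,$$ $$F^U(\delta|x)=1+\int_{\mathbb R^L}\inf_{y\in\mathbb R}\min\big\{I_x[\mathbf 1\{Y\le y\}D](\gamma)-I_x[\mathbf 1\{Y\le y-\delta\}(D-1)](\gamma),\ 0\big\}\,d\gamma .$$ **Theorem.** Under Assumptions 1 and 2, for almost every $x$ with respect to the law of $X$, all the quantities just defined exist, and for every $(y_0,y_1,\delta)\in\mathbb R^3$, $$F^L(y_0,y_1|x)\le F_{Y_0,Y_1|X}(y_0,y_1|x)\le F^U(y_0,y_1|x),\qquad F^L(\delta|x)\le F_{\Delta|X}(\delta|x)\le F^U(\delta|x).$$ If in addition $\mathbb E[Y_0^2+Y_1^2]<\infty$, then for almost every $x$, $\mathbb E[\Delta^2\mid X=x]<\infty$, the quantities below exist, and $$\Big(\operatorname{Var}(\Delta|X=x)+\Big(\int_{\mathbb R^L} I_x[Y](\gamma)\,d\gamma\Big)^2+\int_{\mathbb R^L} I_x[(1-2D)Y^2](\gamma)\,d\gamma\Big)^2\le 4\int_{\mathbb R^L} I_x[(D-1)Y^2](\gamma)\,d\gamma\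 \int_{\mathbb R^L} I_x[DY^2](\gamma)\,d\gamma .$$ -/

import Mathlib

open MeasureTheory ProbabilityTheory Set

namespace RandCoef

noncomputable section

/-! ### Spaces

The instruments `(V, Z)` and the first-stage coefficients `(Γ, Θ)` have `L = n + 1` coordinates. -/

/-- `ℝⁿ` with the Euclidean norm. -/
abbrev Euc (n : ℕ) : Type := EuclideanSpace ℝ (Fin n)

/-- The unit sphere `𝕊^{L-1}` of `ℝ^L`, where `L = n + 1`. -/
abbrev Sph (n : ℕ) : Type := Metric.sphere (0 : Euc (n + 1)) 1

/-- The spherical (surface) measure on `𝕊^{L-1}`. -/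
def sphMeasure (n : ℕ) : Measure (Sph n) := (volume : Measure (Euc (n + 1))).toSphere

/-- The open upper hemisphere `H⁺ = {s ∈ 𝕊^{L-1} : s_L > 0}`. -/
def upper (n : ℕ) : Set (Sph n) := {s | 0 < (s : Euc (n + 1)) (Fin.last n)}

/-- The vector `(z, t) ∈ ℝ^L` for `z ∈ ℝ^{L-1}` and `t ∈ ℝ`. -/
def append {n : ℕ} (z : Euc n) (t : ℝ) : Euc (n + 1) :=
  WithLp.toLp 2 (Fin.snoc (α := fun _ => ℝ) z.ofLp t)

theorem append_one_ne_zero {n : ℕ} (z : Euc n) : append z 1 ≠ 0 := by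
  intro h
  have h1 : (append z 1) (Fin.last n) = (0 : Euc (n + 1)) (Fin.last n) := by rw [h]
  simp [append] at h1

/-- The renormalized instrument `(z, 1) / ‖(z, 1)‖ ∈ 𝕊^{L-1}`. -/
def direction {n : ℕ} (z : Euc n) : Sph n :=
  ⟨‖append z 1‖⁻¹ • append z 1, by
    rw [mem_sphere_zero_iff_norm, norm_smul, norm_inv, norm_norm,
      inv_mul_cancel₀ (norm_ne_zero_iff.mpr (append_one_ne_zero z))]⟩

/-! ### The variables of one unit of the population -/

/-- A unit is described by `(y₀, y₁, v, z, γ, θ)`. The conditional distribution of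
`(Y₀, Y₁, V, Z, Γ, Θ)` given `X = x` is a probability measure on this space. -/
abbrev Pop (n : ℕ) : Type := ℝ × ℝ × ℝ × Euc n × Euc n × ℝ

variable {n : ℕ}

/-- Outcome without treatment `Y₀`. -/
def y0 (w : Pop n) : ℝ := w.1
/-- Outcome with treatment `Y₁`. -/
def y1 (w : Pop n) : ℝ := w.2.1
/-- Instrument `V`, whose coefficient is normalized to `1`. -/
def instrV (w : Pop n) : ℝ := w.2.2.1
/-- Instruments `Z`. -/
def instrZ (w : Pop n) : Euc n := w.2.2.2.1
/-- Random slopes `Γ` of the selection equation. -/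
def slope (w : Pop n) : Euc n := w.2.2.2.2.1
/-- Random intercept `Θ` of the selection equation. -/
def icept (w : Pop n) : ℝ := w.2.2.2.2.2

/-- Treatment effect `Δ = Y₁ - Y₀`. -/
def effect (w : Pop n) : ℝ := y1 w - y0 w

/-- Treatment indicator `D = 1{V - Z'Γ - Θ > 0}`. -/
def treat (w : Pop n) : ℝ :=
  if 0 < instrV w - inner ℝ (instrZ w) (slope w) - icept w then 1 else 0

/-- Observed outcome `Y = Y₀ + Δ D`. -/
def outcome (w : Pop n) : ℝ := y0 w + effect w * treat w

/-- `S̃ = (Z, 1) / ‖(Z, 1)‖`. -/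
def tS (w : Pop n) : Sph n := direction (instrZ w)

/-- `Ṽ = V / ‖(Z, 1)‖`. -/
def tV (w : Pop n) : ℝ := instrV w / ‖append (instrZ w) 1‖

/-- `Γ̃ = (Γ, Θ)`. -/
def tG (w : Pop n) : Euc (n + 1) := append (slope w) (icept w)

/-- The pair of renormalized instruments `(S̃, Ṽ)`. -/
def instr (w : Pop n) : Sph n × ℝ := (tS w, tV w)

/-! ### Regression functions and their derivative -/

/-- The support of `(S̃, Ṽ)` under `ν`. -/
def instrSupport (ν : Measure (Pop n)) : Set (Sph n × ℝ) := (ν.map instr).support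

/-- `m` is the continuous version on `supp (S̃, Ṽ)` of the regression function
`(s, v) ↦ E[W | (S̃, Ṽ) = (s, v)]` under `ν`. Its values on the support are unique. -/
def IsRegression (ν : Measure (Pop n)) (W : Pop n → ℝ) (m : Sph n × ℝ → ℝ) : Prop :=
  ContinuousOn m (instrSupport ν) ∧
    (fun w => m (instr w)) =ᵐ[ν] ν[W | MeasurableSpace.comap instr inferInstance]

open Classical in
/-- The regression function `E[W | (S̃, Ṽ) = ·]` under `ν`. -/
def regression (ν : Measure (Pop n)) (W : Pop n → ℝ) : Sph n × ℝ → ℝ :=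
  if h : ∃ m, IsRegression ν W m then h.choose else 0

open Classical in
/-- The derivative `∂_v E[W | (S̃, Ṽ) = (s, ·)](u)` of the regression function within its domain
`supp (S̃, Ṽ)`, extended by `0` outside of this domain. -/
def dReg (ν : Measure (Pop n)) (W : Pop n → ℝ) (s : Sph n) (u : ℝ) : ℝ :=
  if (s, u) ∈ instrSupport ν then
    derivWithin (fun v => regression ν W (s, v)) {v | (s, v) ∈ instrSupport ν} u
  else 0

/-! ### The Radon transform and its inverse -/

/-- The Radon transform `R[f](s, u)`: the integral of `f` over the affine hyperplane
`{γ : ⟪s, γ⟫ = u} = u s + s^⊥` with respect to its `(L-1)`-dimensional Lebesgue measure.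
For `L = 1` the hyperplane is the point `u s` with unit mass, so `R[f](1, u) = f u`. -/
def radon (f : Euc (n + 1) → ℝ) (s : Sph n) (u : ℝ) : ℝ :=
  ∫ h : (Submodule.span ℝ {(s : Euc (n + 1))})ᗮ, f (u • (s : Euc (n + 1)) + (h : Euc (n + 1)))

/-- `f ∈ L¹(ℝ^L)` and `R[f] = g` almost everywhere on `H⁺ × ℝ`. -/
def IsRadonInverse (g : Sph n → ℝ → ℝ) (f : Euc (n + 1) → ℝ) : Prop :=
  Integrable f ∧
    ∀ᵐ p ∂(((sphMeasure n).restrict (upper n)).prod (volume : Measure ℝ)),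
      radon f p.1 p.2 = g p.1 p.2

open Classical in
/-- The inverse Radon transform `R⁻¹[g]`, an element of `L¹(ℝ^L)` determined up to null sets. -/
def radonInv (g : Sph n → ℝ → ℝ) : Euc (n + 1) → ℝ :=
  if h : ∃ f, IsRadonInverse g f then h.choose else 0

/-- A version of `(y, γ) ↦ R⁻¹[g_y](γ)` that is right-continuous in `y`. Since `R⁻¹[g_y]` is only
determined up to a null set for each `y`, this is what gives a meaning to suprema over all real `y`
at a given `γ`: two such versions agree for almost every `γ` simultaneously for all `y`. -/
def IsRadonInverseFamily (g : ℝ → Sph n → ℝ → ℝ) (F : ℝ → Euc (n + 1) → ℝ) : Prop :=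
  (∀ y, IsRadonInverse (g y) (F y)) ∧
    ∀ γ y, ContinuousWithinAt (fun t => F t γ) (Ici y) y

open Classical in
/-- The right-continuous version of `(y, γ) ↦ R⁻¹[g_y](γ)`. -/
def radonInvFamily (g : ℝ → Sph n → ℝ → ℝ) : ℝ → Euc (n + 1) → ℝ :=
  if h : ∃ F, IsRadonInverseFamily g F then h.choose else 0

/-- `R⁻¹[∂_v E[W | (S̃, Ṽ) = ·]]` under `ν`. -/
def ident (ν : Measure (Pop n)) (W : Pop n → ℝ) : Euc (n + 1) → ℝ := radonInv (dReg ν W)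

/-- `(y, γ) ↦ R⁻¹[∂_v E[W_y | (S̃, Ṽ) = ·]](γ)` under `ν`, right-continuous in `y`. -/
def identFamily (ν : Measure (Pop n)) (W : ℝ → Pop n → ℝ) : ℝ → Euc (n + 1) → ℝ :=
  radonInvFamily fun y => dReg ν (W y)

/-- The regression function of `W` and the inverse Radon transform of its derivative exist. -/
def Identified (ν : Measure (Pop n)) (W : Pop n → ℝ) : Prop :=
  (∃ m, IsRegression ν W m) ∧ ∃ f, IsRadonInverse (dReg ν W) f

/-- The regression functions of all `W_y` and the right-continuous family of inverse Radon
transforms of their derivatives exist. -/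
def IdentifiedFamily (ν : Measure (Pop n)) (W : ℝ → Pop n → ℝ) : Prop :=
  (∀ y, ∃ m, IsRegression ν (W y) m) ∧ ∃ F, IsRadonInverseFamily (fun y => dReg ν (W y)) F

/-! ### The assumptions, for the conditional distribution `ν` given `X = x` -/

/-- Given `X = x`, the law of `(S̃, Ṽ, Γ̃)` is absolutely continuous with respect to the product
of the spherical measure and Lebesgue measure. -/
def AbsCont (ν : Measure (Pop n)) : Prop :=
  ν.map (fun w => (tS w, tV w, tG w)) ≪
    (sphMeasure n).prod ((volume : Measure ℝ).prod (volume : Measure (Euc (n + 1))))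

/-- Given `X = x`, the instruments `(V, Z)` are independent of `(Y₀, Γ, Θ)` and of
`(Y₁, Γ, Θ)`. -/
def Exogenous (ν : Measure (Pop n)) : Prop :=
  IndepFun (fun w => (instrV w, instrZ w)) (fun w => (y0 w, slope w, icept w)) ν ∧
    IndepFun (fun w => (instrV w, instrZ w)) (fun w => (y1 w, slope w, icept w)) ν

/-- `0 < P(D = 1 | X = x) < 1`. -/
def Overlap (ν : Measure (Pop n)) : Prop :=
  0 < ν {w | treat w = 1} ∧ ν {w | treat w = 1} < 1

/-- The large support condition given `X = x`. When `L = 1`: `supp V ⊇ supp Θ`. When `L ≥ 2`: the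
support of `S̃` is the closed hemisphere and, given `S̃ = s`, the support of `Ṽ` contains
`[inf s'γ, sup s'γ]`, with `γ` running over the support of `Γ̃` (the bounds may be infinite). -/
def LargeSupport (ν : Measure (Pop n)) [IsFiniteMeasure ν] : Prop :=
  (n = 0 → (ν.map icept).support ⊆ (ν.map instrV).support) ∧
  (1 ≤ n →
    (ν.map tS).support = closure (upper n) ∧
    ∀ᵐ s : Sph n ∂(ν.map tS),
      {v : ℝ |
        (⨅ γ ∈ (ν.map tG).support, ((inner ℝ (s : Euc (n + 1)) γ : ℝ) : EReal)) ≤ (v : EReal) ∧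
        (v : EReal) ≤ ⨆ γ ∈ (ν.map tG).support, ((inner ℝ (s : Euc (n + 1)) γ : ℝ) : EReal)} ⊆
        (condDistrib tV tS ν s).support)

/-! ### The bounds -/

/-- `1{Y ≤ y} D`. -/
def treatedBelow (y : ℝ) (w : Pop n) : ℝ := (if outcome w ≤ y then 1 else 0) * treat w

/-- `1{Y ≤ y} (D - 1)`. -/
def untreatedBelow (y : ℝ) (w : Pop n) : ℝ := (if outcome w ≤ y then 1 else 0) * (treat w - 1)

/-- `1{Y ≤ y_D} (2D - 1)`, where `y_D` is `y₁` for the treated and `y₀` for the untreated. -/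
def jointBelow (a0 a1 : ℝ) (w : Pop n) : ℝ :=
  (if outcome w ≤ (if treat w = 1 then a1 else a0) then 1 else 0) * (2 * treat w - 1)

/-- Lower bound `F^L(y₀, y₁ | x)` on the joint CDF. -/
def jointLower (ν : Measure (Pop n)) (a0 a1 : ℝ) : ℝ :=
  max ((∫ γ, ident ν (jointBelow a0 a1) γ) - 1) 0

/-- Upper bound `F^U(y₀, y₁ | x)` on the joint CDF. -/
def jointUpper (ν : Measure (Pop n)) (a0 a1 : ℝ) : ℝ :=
  min (∫ γ, ident ν (untreatedBelow a0) γ) (∫ γ, ident ν (treatedBelow a1) γ)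

/-- Integrand of the lower bound `F^L(δ | x)`. -/
def effectLowerAt (ν : Measure (Pop n)) (δ : ℝ) (γ : Euc (n + 1)) : ℝ :=
  ⨆ y : ℝ, max (identFamily ν treatedBelow y γ - identFamily ν untreatedBelow (y - δ) γ) 0

/-- Integrand of the upper bound `F^U(δ | x)`. -/
def effectUpperAt (ν : Measure (Pop n)) (δ : ℝ) (γ : Euc (n + 1)) : ℝ :=
  ⨅ y : ℝ, min (identFamily ν treatedBelow y γ - identFamily ν untreatedBelow (y - δ) γ) 0

/-- Lower bound `F^L(δ | x)` on the CDF of the treatment effect. -/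
def effectLower (ν : Measure (Pop n)) (δ : ℝ) : ℝ := ∫ γ, effectLowerAt ν δ γ

/-- Upper bound `F^U(δ | x)` on the CDF of the treatment effect. -/
def effectUpper (ν : Measure (Pop n)) (δ : ℝ) : ℝ := 1 + ∫ γ, effectUpperAt ν δ γ

/-! ### Random variables -/

/-- The vector `(Y₀, Y₁, V, Z, Γ, Θ)`. -/
def pop {Ω : Type*} (Y0 Y1 V : Ω → ℝ) (Z Γ : Ω → Euc n) (Θ : Ω → ℝ) (ω : Ω) : Pop n :=
  (Y0 ω, Y1 ω, V ω, Z ω, Γ ω, Θ ω)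

end

end RandCoef

/-! Fix `x` and let `ν` be the law given `X = x`. Everything rests on one identification formula.
Take `W = D a(Y₁) + (1 - D) b(Y₀)`. Since `D = 1{S̃'Γ̃ < Ṽ}` and the instruments are independent of
each `(Y_d, Γ̃)`, the regression function of `W` at `(s, v)` is `E b(Y₀)` plus the integral over the
half-space `{s'γ < v}` of `G(γ) = f_Γ̃(γ) E[a(Y₁) - b(Y₀) | Γ̃ = γ]`. By Fubini and Lebesgue
differentiation its derivative in `v` is `R[G](s, v)` for almost every `(s, v)`, so the inverse
Radon transform returns `G`, whose integral is `E a(Y₁) - E b(Y₀)` (`Regular.identification`,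
`Regular.identified`).

Two points need care. The derivative is taken only inside the support of `(S̃, Ṽ)` and set to `0`
elsewhere: large support ensures that almost every point where `R[G]` does not vanish is an
accumulation point of the support along `v`, where the derivative within the support is the true one
(`accPt_of_deriv_ne_zero`, `isRadonInverse_dReg`). And `R⁻¹` is an arbitrary choice, so the Radon
transform on `H⁺` must be injective on `L¹`, which the Fourier slice theorem gives
(`IsRadonInverse.ae_eq`).

The bounds are then classical inequalities: Fréchet–Hoeffding for the joint law; Makarov's
inequalities applied conditionally on `Γ̃ = γ` and then integrated for the law of `Δ`;
Cauchy–Schwarz for `E[Y₀ Y₁]` for the variance. -/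

namespace RandCoef

noncomputable section

variable {n : ℕ}

/-! ### Fubini along the hyperplanes orthogonal to a direction -/

/-- The hyperplane of vectors orthogonal to `s`. -/
abbrev orth (s : Sph n) : Submodule ℝ (Euc (n + 1)) := (Submodule.span ℝ {(s : Euc (n + 1))})ᗮ

/-- The coordinates `(u, h) ↦ u s + h`. -/
def slice (s : Sph n) (p : ℝ × orth s) : Euc (n + 1) := p.1 • (s : Euc (n + 1)) + p.2

theorem norm_sph (s : Sph n) : ‖(s : Euc (n + 1))‖ = 1 := by simp

theorem continuous_slice (s : Sph n) : Continuous (slice s) := by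
  unfold slice; fun_prop

theorem inner_slice (s : Sph n) (p : ℝ × orth s) : inner ℝ (s : Euc (n + 1)) (slice s p) = p.1 := by
  have h := Submodule.mem_orthogonal_singleton_iff_inner_right.mp p.2.2
  simp [slice, inner_add_right, inner_smul_right, h]

theorem slice_injective (s : Sph n) : Function.Injective (slice s) := by
  intro p q h
  have h1 : p.1 = q.1 := by rw [← inner_slice s p, h, inner_slice]
  refine Prod.ext h1 (Subtype.ext ?_)
  simpa [slice, h1] using h

/-- The orthogonal decomposition of `ℝ^L` along `ℝ s` is an isometry, as is `u ↦ u s` because `s` is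
a unit vector; the only other ingredient is that the product and Euclidean structures on the pair
carry the same volume. -/
theorem measurePreserving_slice (s : Sph n) : MeasurePreserving (slice s) := by
  let K := Submodule.span ℝ {(s : Euc (n + 1))}
  have h1 := (LinearIsometryEquiv.toSpanUnitSingleton (𝕜 := ℝ) (s : Euc (n + 1))
    (norm_sph s)).measurePreserving
  have h2 := (h1.prod (MeasurePreserving.id (volume : Measure (orth s))))
  have h3 := WithLp.volume_preserving_toLp K Kᗮ
  have h4 := K.orthogonalDecomposition.symm.measurePreserving
  have h5 := h4.comp (h3.comp h2)
  convert! h5 using 1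

theorem measurableEmbedding_slice (s : Sph n) : MeasurableEmbedding (slice s) :=
  (continuous_slice s).measurableEmbedding (slice_injective s)

theorem integrable_slice {E : Type*} [NormedAddCommGroup E] {f : Euc (n + 1) → E}
    (hf : Integrable f) (s : Sph n) : Integrable (fun p => f (slice s p)) :=
  (measurePreserving_slice s).integrable_comp_of_integrable hf

theorem integrable_radon {f : Euc (n + 1) → ℝ} (hf : Integrable f) (s : Sph n) :
    Integrable (radon f s) :=
  Integrable.integral_prod_left (integrable_slice hf s)

/-- Fubini in the coordinates `(u, h)`. It is used with `φ` a complex exponential, which gives the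
Fourier slice theorem, and with `φ` the indicator of a half-line, which gives half-space integrals.
-/
theorem integral_radon_smul {E : Type*} [NormedAddCommGroup E] [NormedSpace ℝ E]
    [CompleteSpace E] {f : Euc (n + 1) → ℝ} (s : Sph n) {φ : ℝ → E}
    (h : Integrable fun γ : Euc (n + 1) => f γ • φ (inner ℝ (s : Euc (n + 1)) γ)) :
    ∫ u, radon f s u • φ u = ∫ γ, f γ • φ (inner ℝ (s : Euc (n + 1)) γ) := by
  rw [← (measurePreserving_slice s).integral_comp (measurableEmbedding_slice s)]
  have h2 := integrable_slice h s
  rw [Measure.volume_eq_prod] at h2 ⊢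
  rw [integral_prod _ h2]
  refine integral_congr_ae (.of_forall fun u => ?_)
  simp only [inner_slice]
  rw [integral_smul_const]
  rfl

/-! ### Joint measurability of the Radon transform -/

/-- A reference direction. -/
def north (n : ℕ) : Sph n := ⟨EuclideanSpace.single (Fin.last n) 1, by simp⟩

/-- The reflection exchanging the reference direction and `s`. -/
def swapTo (s : Sph n) : Euc (n + 1) ≃ₗᵢ[ℝ] Euc (n + 1) :=
  (ℝ ∙ ((north n : Euc (n + 1)) - s))ᗮ.reflection

theorem swapTo_north (s : Sph n) : swapTo s (north n) = s :=
  Submodule.reflection_sub (by simp)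

/-- This explicit formula makes measurability in `s` visible. At `s = north n` division by zero
yields `0`, so the formula gives the identity, as the reflection does. -/
theorem swapTo_apply (s : Sph n) (x : Euc (n + 1)) :
    swapTo s x = x - (2 : ℝ) • (inner ℝ ((north n : Euc (n + 1)) - s) x
      / ‖(north n : Euc (n + 1)) - s‖ ^ 2) • ((north n : Euc (n + 1)) - s) := by
  rw [swapTo, Submodule.reflection_orthogonal_apply, Submodule.reflection_singleton_apply]
  simp only [RCLike.ofReal_real_eq_id, id_eq, neg_sub, two_smul]

theorem map_swapTo (s : Sph n) :
    (orth (north n)).map ((swapTo s).toLinearEquiv : Euc (n + 1) →ₗ[ℝ] Euc (n + 1)) = orth s := by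
  rw [orth, Submodule.map_orthogonal_equiv, Submodule.map_span]
  simp [swapTo_north s]

theorem integral_submodule_map {E F : Type*} [NormedAddCommGroup E] [InnerProductSpace ℝ E]
    [FiniteDimensional ℝ E] [MeasurableSpace E] [BorelSpace E] [NormedAddCommGroup F]
    [NormedSpace ℝ F] (R : E ≃ₗᵢ[ℝ] E)
    {K K' : Submodule ℝ E} (h : K.map (R.toLinearEquiv : E →ₗ[ℝ] E) = K') (g : E → F) :
    ∫ x : K', g x = ∫ x : K, g (R x) := by
  subst h
  have := ((LinearIsometryEquiv.submoduleMap K R).measurePreserving).integral_comp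
    (LinearIsometryEquiv.submoduleMap K R).toHomeomorph.measurableEmbedding (fun x => g x)
  exact this.symm

/-- The domain of integration in `radon` moves with `s`. Pulling it back by the reflection puts all
the integrals on one fixed hyperplane, where joint measurability in `(s, u)` can be read off. -/
theorem radon_eq (f : Euc (n + 1) → ℝ) (s : Sph n) (u : ℝ) :
    radon f s u = ∫ h : orth (north n), f (swapTo s (slice (north n) (u, h))) := by
  rw [radon, integral_submodule_map (swapTo s) (map_swapTo s) (fun x => f (u • (s : Euc (n + 1)) + x))]
  simp [slice, swapTo_north]

theorem stronglyMeasurable_radon {f : Euc (n + 1) → ℝ} (hf : StronglyMeasurable f) :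
    StronglyMeasurable (fun p : Sph n × ℝ => radon f p.1 p.2) := by
  simp only [radon_eq]
  refine StronglyMeasurable.integral_prod_right (f := fun (p : Sph n × ℝ) (h : orth (north n)) =>
    f (swapTo p.1 (slice (north n) (p.2, h)))) ?_
  refine hf.comp_measurable ?_
  have hc := (continuous_slice (north n)).measurable
  have hm : Measurable fun q : (Sph n × ℝ) × orth (north n) => slice (north n) (q.1.2, q.2) :=
    hc.comp (by fun_prop)
  simp only [swapTo_apply]
  have hs : Measurable fun q : (Sph n × ℝ) × orth (north n) =>
    (north n : Euc (n + 1)) - (q.1.1 : Euc (n + 1)) :=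
    measurable_const.sub (measurable_subtype_coe.comp (by fun_prop))
  exact hm.sub ((((hs.inner hm).div (hs.norm.pow_const 2)).smul hs).const_smul (2 : ℝ))

/-! ### Injectivity of the Radon transform -/

theorem integrable_smul_exp {E : Type*} [NormedAddCommGroup E] [InnerProductSpace ℝ E]
    [FiniteDimensional ℝ E] [MeasurableSpace E] [BorelSpace E] {μ : Measure E}
    {f : E → ℝ} (hf : Integrable f μ) (t : E) :
    Integrable (fun x => f x • Complex.exp ((inner ℝ x t : ℝ) * Complex.I)) μ := by
  refine Integrable.smul_bdd hf 1 (by fun_prop) (.of_forall fun x => ?_)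
  rw [Complex.norm_exp_ofReal_mul_I]

/-- The positive and negative parts of `f` are densities of two finite measures with the same
characteristic function, hence of the same measure. -/
theorem ae_eq_zero_of_fourier {E : Type*} [NormedAddCommGroup E] [InnerProductSpace ℝ E]
    [FiniteDimensional ℝ E] [MeasurableSpace E] [BorelSpace E] {μ : Measure E}
    {f : E → ℝ} (hf : Integrable f μ)
    (h : ∀ t, ∫ x, f x • Complex.exp ((inner ℝ x t : ℝ) * Complex.I) ∂μ = 0) : f =ᵐ[μ] 0 := by
  have hp := hf.real_toNNReal
  have hn := hf.neg.real_toNNReal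
  have hpm := hf.aemeasurable.real_toNNReal.coe_nnreal_ennreal
  have hnm := hf.neg.aemeasurable.real_toNNReal.coe_nnreal_ennreal
  have key (t : E) (g : E → ℝ) (hg : Integrable g μ) :
      charFun (μ.withDensity fun x => ((g x).toNNReal : ENNReal)) t =
      ∫ x, ((g x).toNNReal : ℝ) • Complex.exp ((inner ℝ x t : ℝ) * Complex.I) ∂μ := by
    rw [charFun_apply, integral_withDensity_eq_integral_smul₀ hg.aemeasurable.real_toNNReal]
    rfl
  have fin (g : E → ℝ) (hg : Integrable g μ) :
      ∫⁻ x, ((g x).toNNReal : ENNReal) ∂μ ≠ ⊤ := by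
    have := hg.real_toNNReal.2
    simpa only [HasFiniteIntegral, NNReal.enorm_eq, Real.enorm_of_nonneg (NNReal.coe_nonneg _),
      ENNReal.ofReal_coe_nnreal] using this.ne
  have := isFiniteMeasure_withDensity (fin f hf)
  have := isFiniteMeasure_withDensity (fin (-f) hf.neg)
  have hm : (μ.withDensity fun x => ((f x).toNNReal : ENNReal)) =
      μ.withDensity fun x => (((-f) x).toNNReal : ENNReal) := by
    refine Measure.ext_of_charFun (funext fun t => ?_)
    rw [key t f hf, key t (-f) hf.neg, ← sub_eq_zero, ← integral_sub, ← h t]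
    · congr 1; ext x
      rw [← sub_smul]
      congr 1
      simp only [Real.coe_toNNReal', Pi.neg_apply]
      rcases le_total 0 (f x) with h | h <;> simp [h]
    · exact integrable_smul_exp hp t
    · exact integrable_smul_exp hn t
  have := (withDensity_eq_iff hpm hnm (fin f hf)).mp hm
  filter_upwards [this] with x hx
  simp only [ENNReal.coe_inj, Pi.neg_apply] at hx
  have := congrArg NNReal.toReal hx
  simp only [Real.coe_toNNReal'] at this
  show f x = 0
  rcases le_total 0 (f x) with h | h <;> simp [h] at this <;> linarith

/-- Fourier slice theorem: the Fourier transform `F` of `f - f'` at `t s` is the one-dimensional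
transform at `t` of `R[f - f'](s, ·)`. So `F` vanishes on the lines spanned by almost every `s` in
`H⁺`, and by continuity everywhere. -/
theorem IsRadonInverse.ae_eq {g : Sph n → ℝ → ℝ} {f f' : Euc (n + 1) → ℝ}
    (hf : IsRadonInverse g f) (hf' : IsRadonInverse g f') : f =ᵐ[volume] f' := by
  have hexp (k : Euc (n + 1) → ℝ) (hk : Integrable k) (t : Euc (n + 1)) :
      Integrable fun x => k x • Complex.exp ((inner ℝ x t : ℝ) * Complex.I) :=
    integrable_smul_exp hk t
  set F : Euc (n + 1) → ℂ := fun t =>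
    ∫ x, (f x - f' x) • Complex.exp ((inner ℝ x t : ℝ) * Complex.I) with hF
  have hcont : Continuous F := by
    refine continuous_of_dominated (bound := fun x => ‖f x - f' x‖)
      (fun t => (hexp (fun x => f x - f' x) (hf.1.sub hf'.1) t).1) (fun t => .of_forall fun x => ?_)
      (hf.1.sub hf'.1).norm (.of_forall fun x => ?_)
    · rw [norm_smul, Complex.norm_exp_ofReal_mul_I, mul_one]
    · fun_prop
  have hsec : ∀ᵐ s : Sph n ∂((sphMeasure n).restrict (upper n)), ∀ t : ℝ, F (t • (s : Euc (n + 1))) = 0 := by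
    have h1 := Measure.ae_ae_of_ae_prod hf.2
    have h2 := Measure.ae_ae_of_ae_prod hf'.2
    filter_upwards [h1, h2] with s hs hs' t
    have e (k : Euc (n + 1) → ℝ) (hk : Integrable k) :
        ∫ x, k x • Complex.exp ((inner ℝ x (t • (s : Euc (n + 1))) : ℝ) * Complex.I) =
        ∫ u, radon k s u • Complex.exp (((t * u : ℝ) : ℂ) * Complex.I) := by
      have := hexp k hk (t • (s : Euc (n + 1)))
      simp only [inner_smul_right, real_inner_comm (s : Euc (n + 1))] at this ⊢
      exact (integral_radon_smul (φ := fun u => Complex.exp (((t * u : ℝ) : ℂ) * Complex.I))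
        s this).symm
    have : F (t • (s : Euc (n + 1))) = (∫ x, f x • Complex.exp ((inner ℝ x (t • (s : Euc (n + 1))) : ℝ)
        * Complex.I)) - ∫ x, f' x • Complex.exp ((inner ℝ x (t • (s : Euc (n + 1))) : ℝ)
        * Complex.I) := by
      rw [← integral_sub (hexp f hf.1 _) (hexp f' hf'.1 _)]
      simp only [hF, sub_smul]
    rw [this, e f hf.1, e f' hf'.1, sub_eq_zero]
    refine integral_congr_ae ?_
    filter_upwards [hs, hs'] with u hu hu'
    rw [hu, hu']
  have : (sphMeasure n).IsOpenPosMeasure :=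
    inferInstanceAs (volume : Measure (Euc (n + 1))).toSphere.IsOpenPosMeasure
  -- A nonzero value would persist on an open subset of `H⁺`, which has positive spherical measure.
  have hup : ∀ s ∈ upper n, ∀ t : ℝ, F (t • (s : Euc (n + 1))) = 0 := by
    intro s hs t
    have ho : IsOpen (upper n) := by
      unfold upper
      exact isOpen_lt continuous_const (by fun_prop)
    by_contra hne
    have hU : IsOpen (upper n ∩ {s : Sph n | F (t • (s : Euc (n + 1))) ≠ 0}) :=
      ho.inter (isOpen_ne_fun (hcont.comp (by fun_prop)) continuous_const)
    have hpos : 0 < sphMeasure n (upper n ∩ {s : Sph n | F (t • (s : Euc (n + 1))) ≠ 0}) :=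
      IsOpen.measure_pos (sphMeasure n) hU ⟨s, hs, hne⟩
    rw [ae_restrict_iff' ho.measurableSet] at hsec
    refine hpos.ne' (measure_mono_null ?_ hsec)
    rintro r ⟨hr, hr2⟩ hr3
    exact hr2 (hr3 hr t)
  -- Half of the sphere suffices because `t` takes both signs: `x = t s` with `s ∈ H⁺` and `t =
  -- ±‖x‖`, the sign being that of the last coordinate of `x`.
  have hne0 : ∀ x : Euc (n + 1), x (Fin.last n) ≠ 0 → F x = 0 := by
    intro x hx
    have hx0 : x ≠ 0 := by rintro rfl; simp at hx
    have hpos : 0 < ‖x‖ := norm_pos_iff.mpr hx0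
    rcases lt_or_gt_of_ne hx with h | h
    · have := hup ⟨(-‖x‖⁻¹) • x, by
        rw [mem_sphere_zero_iff_norm, norm_smul, norm_neg, norm_inv, norm_norm,
          inv_mul_cancel₀ hpos.ne']⟩ (by
          simp only [upper, Set.mem_ofPred_eq, PiLp.smul_apply, smul_eq_mul]
          have := inv_pos.mpr hpos; nlinarith) (-‖x‖)
      rwa [smul_smul, neg_mul_neg, mul_inv_cancel₀ hpos.ne', one_smul] at this
    · have := hup ⟨(‖x‖⁻¹) • x, by
        rw [mem_sphere_zero_iff_norm, norm_smul, norm_inv, norm_norm,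
          inv_mul_cancel₀ hpos.ne']⟩ (by
          simp only [upper, Set.mem_ofPred_eq, PiLp.smul_apply, smul_eq_mul]
          have := inv_pos.mpr hpos; positivity) (‖x‖)
      rwa [smul_smul, mul_inv_cancel₀ hpos.ne', one_smul] at this
  -- The equatorial hyperplane is approached in the direction `north n`, along points with nonzero
  -- last coordinate.
  have hzero : ∀ x, F x = 0 := by
    intro x
    have hdir : Filter.Tendsto (fun k : ℝ => F (x + k • (north n : Euc (n + 1))))
        (nhdsWithin 0 {0}ᶜ) (nhds (F x)) := by
      have : Continuous fun k : ℝ => F (x + k • (north n : Euc (n + 1))) :=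
        hcont.comp (by fun_prop)
      simpa using (this.tendsto 0).mono_left nhdsWithin_le_nhds
    refine tendsto_nhds_unique hdir (tendsto_const_nhds.congr' ?_)
    have hev : ∀ᶠ k : ℝ in nhdsWithin 0 {0}ᶜ, k ≠ - x (Fin.last n) := by
      by_cases h : x (Fin.last n) = 0
      · rw [h, neg_zero]; exact self_mem_nhdsWithin
      · exact nhdsWithin_le_nhds (isOpen_ne.mem_nhds (by
          simp only [Set.mem_ofPred_eq]; intro h'; exact h (by linarith)))
    filter_upwards [hev] with k hk
    refine (hne0 _ ?_).symm
    simp only [north, PiLp.add_apply, PiLp.smul_apply, PiLp.single_apply, smul_eq_mul,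
      if_true, mul_one]
    intro h; exact hk (by linarith)
  have := ae_eq_zero_of_fourier (hf.1.sub hf'.1) hzero
  filter_upwards [this] with x hx
  exact sub_eq_zero.mp hx

theorem radonInv_ae_eq {g : Sph n → ℝ → ℝ} {f : Euc (n + 1) → ℝ} (hf : IsRadonInverse g f) :
    radonInv g =ᵐ[volume] f := by
  have h : ∃ f, IsRadonInverse g f := ⟨f, hf⟩
  rw [radonInv, dif_pos h]
  exact h.choose_spec.ae_eq hf

/-! ### Integrals over half-spaces -/

/-- The integral of `G` over the half-space `{γ : ⟪s, γ⟫ < v}`. -/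
def halfMass (G : Euc (n + 1) → ℝ) (s : Sph n) (v : ℝ) : ℝ :=
  ∫ γ, (Iio v).indicator (fun _ => G γ) (inner ℝ (s : Euc (n + 1)) γ)

theorem ae_inner_ne (s : Sph n) (v : ℝ) :
    ∀ᵐ γ : Euc (n + 1), inner ℝ (s : Euc (n + 1)) γ ≠ v := by
  have hm : MeasurableSet {γ : Euc (n + 1) | inner ℝ (s : Euc (n + 1)) γ = v} :=
    measurableSet_eq_fun (by fun_prop) measurable_const
  rw [ae_iff]
  simp only [not_not]
  rw [← (measurePreserving_slice s).measure_preimage hm.nullMeasurableSet]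
  have : slice s ⁻¹' {γ : Euc (n + 1) | inner ℝ (s : Euc (n + 1)) γ = v} = {v} ×ˢ univ := by
    ext p; simp [inner_slice]
  rw [this, Measure.volume_eq_prod, Measure.prod_prod]
  simp

theorem indicator_Iio_smul (G : Euc (n + 1) → ℝ) (v t : ℝ) (γ : Euc (n + 1)) :
    (Iio v).indicator (fun _ => G γ) t = G γ • (Iio v).indicator (fun _ => (1 : ℝ)) t := by
  by_cases h : t ∈ Iio v <;> simp [h]

theorem measurable_indicator_Iio_inner (s : Sph n) (v : ℝ) :
    Measurable fun γ : Euc (n + 1) =>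
      (Iio v).indicator (fun _ => (1 : ℝ)) (inner ℝ (s : Euc (n + 1)) γ) :=
  (measurable_const.indicator measurableSet_Iio).comp
    (g := (Iio v).indicator fun _ => (1 : ℝ)) (by fun_prop)

theorem integrable_indicator_Iio {G : Euc (n + 1) → ℝ} (hG : Integrable G) (s : Sph n) (v : ℝ) :
    Integrable fun γ => (Iio v).indicator (fun _ => G γ) (inner ℝ (s : Euc (n + 1)) γ) := by
  simp only [indicator_Iio_smul]
  refine hG.smul_bdd 1 (measurable_indicator_Iio_inner s v).aestronglyMeasurable
    (.of_forall fun γ => ?_)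
  refine (norm_indicator_le_norm_self _ _).trans (by simp)

/-- Dominated convergence: the indicator of the half-space is continuous in `(s, v)` except for `γ`
on the bounding hyperplane, which is a null set. -/
theorem continuous_halfMass {G : Euc (n + 1) → ℝ} (hG : Integrable G) :
    Continuous fun p : Sph n × ℝ => halfMass G p.1 p.2 := by
  rw [continuous_iff_continuousAt]
  intro p
  refine continuousAt_of_dominated (bound := fun γ => ‖G γ‖)
    (.of_forall fun q => (integrable_indicator_Iio hG q.1 q.2).1)
    (.of_forall fun q => .of_forall fun γ => norm_indicator_le_norm_self _ _) hG.norm ?_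
  filter_upwards [ae_inner_ne p.1 p.2] with γ hγ
  have hc : Continuous fun q : Sph n × ℝ => inner ℝ (q.1 : Euc (n + 1)) γ := by fun_prop
  rcases lt_or_gt_of_ne hγ with h | h
  · have hev : ∀ᶠ q : Sph n × ℝ in nhds p, inner ℝ (q.1 : Euc (n + 1)) γ < q.2 :=
      hc.continuousAt.eventually_lt continuous_snd.continuousAt h
    refine (continuousAt_const (y := G γ)).congr ?_
    filter_upwards [hev] with q hq
    simp [hq]
  · have hev : ∀ᶠ q : Sph n × ℝ in nhds p, q.2 < inner ℝ (q.1 : Euc (n + 1)) γ :=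
      continuous_snd.continuousAt.eventually_lt hc.continuousAt h
    refine (continuousAt_const (y := (0 : ℝ))).congr ?_
    filter_upwards [hev] with q hq
    simp [hq.le]

theorem halfMass_eq {G : Euc (n + 1) → ℝ} (hG : Integrable G) (s : Sph n) (v : ℝ) :
    halfMass G s v = ∫ u in Iio v, radon G s u := by
  have h := integrable_indicator_Iio hG s v
  simp only [indicator_Iio_smul] at h
  have := integral_radon_smul (φ := (Iio v).indicator fun _ => (1 : ℝ)) s h
  rw [halfMass]
  simp only [indicator_Iio_smul]
  rw [← this, ← integral_indicator measurableSet_Iio]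
  congr 1; ext u
  by_cases hu : u ∈ Iio v <;> simp [hu]

theorem ae_hasDerivAt_halfMass {G : Euc (n + 1) → ℝ} (hG : Integrable G) (s : Sph n) :
    ∀ᵐ u, HasDerivAt (halfMass G s) (radon G s u) u := by
  have hi := integrable_radon hG s
  filter_upwards [LocallyIntegrable.ae_hasDerivAt_integral hi.locallyIntegrable] with u hu
  have : halfMass G s = fun v => (∫ t in Iic 0, radon G s t) + ∫ t in (0 : ℝ)..v, radon G s t := by
    ext v
    rw [halfMass_eq hG, ← integral_Iic_eq_integral_Iio,
      ← intervalIntegral.integral_Iic_sub_Iic hi.integrableOn hi.integrableOn]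
    ring
  rw [this]
  exact (hu 0).const_add _

/-- Differentiability holds for almost every `u` at each fixed `s`. Passing to almost every pair
requires the exceptional set to be jointly measurable, hence the measurability of `radon` and of the
parametrized derivative. -/
theorem ae_prod_hasDerivAt_halfMass {G : Euc (n + 1) → ℝ} (hG : Integrable G)
    (hGm : StronglyMeasurable G) (μ : Measure (Sph n)) [SFinite μ] :
    ∀ᵐ p ∂(μ.prod (volume : Measure ℝ)), HasDerivAt (halfMass G p.1) (radon G p.1 p.2) p.2 := by
  have hc : Continuous (Function.uncurry fun (s : Sph n) (v : ℝ) => halfMass G s v) :=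
    continuous_halfMass hG
  have h1 := measurableSet_of_differentiableAt_with_param ℝ hc
  have h2 := measurableSet_eq_fun (measurable_deriv_with_param hc)
    (stronglyMeasurable_radon hGm).measurable
  have h3 : MeasurableSet {p : Sph n × ℝ | HasDerivAt (halfMass G p.1) (radon G p.1 p.2) p.2} := by
    convert! h1.inter h2 using 1
    ext p
    exact ⟨fun h => ⟨h.differentiableAt, h.deriv⟩, fun ⟨h, h'⟩ => by
      have := h.hasDerivAt
      rwa [h'] at this⟩
  exact (Measure.ae_prod_iff_ae_ae h3).mpr (.of_forall fun s => ae_hasDerivAt_halfMass hG s)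

theorem deriv_halfMass_eq_zero {G : Euc (n + 1) → ℝ} {s : Sph n} {a b u : ℝ} (hu : u ∈ Ioo a b)
    (h : ∀ᵐ γ : Euc (n + 1), inner ℝ (s : Euc (n + 1)) γ ∈ Ioo a b → G γ = 0) :
    deriv (halfMass G s) u = 0 := by
  have hev : halfMass G s =ᶠ[nhds u] fun _ => halfMass G s u := by
    filter_upwards [Ioo_mem_nhds hu.1 hu.2] with v hv
    refine integral_congr_ae ?_
    filter_upwards [h] with γ hγ
    by_cases hm : inner ℝ (s : Euc (n + 1)) γ ∈ Ioo a b
    · simp [hγ hm]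
    · simp only [indicator, mem_Iio]
      have h1 := hv.1; have h2 := hv.2; have h3 := hu.1; have h4 := hu.2
      simp only [mem_Ioo, not_and, not_lt] at hm
      by_cases hl : a < inner ℝ (s : Euc (n + 1)) γ
      · have := hm hl
        rw [if_neg (by linarith), if_neg (by linarith)]
      · rw [if_pos (by linarith), if_pos (by linarith)]
  rw [hev.deriv_eq, deriv_const]

/-! ### Basic facts about the instruments -/

theorem measurable_append : Measurable fun p : Euc n × ℝ => append p.1 p.2 := by
  unfold append
  refine (PiLp.continuous_toLp 2 _).measurable.comp (measurable_pi_lambda _ fun i => ?_)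
  refine Fin.lastCases ?_ (fun j => ?_) i
  · simp only [Fin.snoc_last]; fun_prop
  · simp only [Fin.snoc_castSucc]; fun_prop

theorem measurable_direction : Measurable (direction : Euc n → Sph n) := by
  have h : Measurable fun z : Euc n => append z 1 :=
    measurable_append.comp (f := fun z : Euc n => (z, (1 : ℝ))) (by fun_prop)
  exact (h.norm.inv.smul h).subtype_mk

theorem measurable_instrV : Measurable (instrV : Pop n → ℝ) := by unfold instrV; fun_prop
theorem measurable_instrZ : Measurable (instrZ : Pop n → Euc n) := by unfold instrZ; fun_prop
theorem measurable_slope : Measurable (slope : Pop n → Euc n) := by unfold slope; fun_prop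
theorem measurable_icept : Measurable (icept : Pop n → ℝ) := by unfold icept; fun_prop
theorem measurable_y0 : Measurable (y0 : Pop n → ℝ) := by unfold y0; fun_prop
theorem measurable_y1 : Measurable (y1 : Pop n → ℝ) := by unfold y1; fun_prop

theorem measurable_tS : Measurable (tS : Pop n → Sph n) :=
  measurable_direction.comp measurable_instrZ

theorem measurable_tG : Measurable (tG : Pop n → Euc (n + 1)) :=
  measurable_append.comp (measurable_slope.prodMk measurable_icept)

/-- The renormalized instruments as a function of `(V, Z)`. -/
def normalize (q : ℝ × Euc n) : Sph n × ℝ := (direction q.2, q.1 / ‖append q.2 1‖)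

theorem measurable_normalize : Measurable (normalize : ℝ × Euc n → Sph n × ℝ) := by
  have h : Measurable fun q : ℝ × Euc n => append q.2 1 :=
    measurable_append.comp (f := fun q : ℝ × Euc n => (q.2, (1 : ℝ))) (by fun_prop)
  exact (measurable_direction.comp measurable_snd).prodMk (measurable_fst.div h.norm)

theorem instr_eq (w : Pop n) : instr w = normalize (instrV w, instrZ w) := by
  simp only [instr, tS, tV, normalize]

theorem measurable_instr : Measurable (instr : Pop n → Sph n × ℝ) := by
  simp only [funext instr_eq]
  exact measurable_normalize.comp (measurable_instrV.prodMk measurable_instrZ)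

theorem measurable_tV : Measurable (tV : Pop n → ℝ) := measurable_instr.snd

theorem inner_append (z g : Euc n) (t : ℝ) :
    inner ℝ (append z 1) (append g t) = inner ℝ z g + t := by
  simp [append, PiLp.inner_apply, Fin.sum_univ_castSucc]

theorem treat_eq (w : Pop n) :
    treat w = (Iio (tV w)).indicator (fun _ => 1) (inner ℝ (tS w : Euc (n + 1)) (tG w)) := by
  have hpos : 0 < ‖append (instrZ w) 1‖ := norm_pos_iff.mpr (append_one_ne_zero _)
  have : inner ℝ (tS w : Euc (n + 1)) (tG w) =
      (inner ℝ (instrZ w) (slope w) + icept w) / ‖append (instrZ w) 1‖ := by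
    rw [tG, ← inner_append]
    simp [tS, direction, inner_smul_left, div_eq_inv_mul]
  have h2 : inner ℝ (tS w : Euc (n + 1)) (tG w) < tV w ↔
      0 < instrV w - inner ℝ (instrZ w) (slope w) - icept w := by
    rw [this, tV, div_lt_div_iff_of_pos_right hpos, sub_sub, sub_pos]
  simp only [treat, indicator, mem_Iio, h2]

theorem direction_mem_upper (z : Euc n) : direction z ∈ upper n := by
  have hpos : 0 < ‖append z 1‖ := norm_pos_iff.mpr (append_one_ne_zero _)
  simp only [upper, direction, mem_ofPred_eq, PiLp.smul_apply, smul_eq_mul]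
  refine mul_pos (inv_pos.mpr hpos) ?_
  simp [append]

/-! ### Uniqueness of the continuous regression function on the support -/

theorem ae_instr_mem (ν : Measure (Pop n)) : ∀ᵐ w ∂ν, instr w ∈ instrSupport ν :=
  ae_of_ae_map measurable_instr.aemeasurable
    (mem_ae_iff.mpr Measure.measure_compl_support : ∀ᵐ p ∂(ν.map instr), p ∈ instrSupport ν)

theorem isClosed_instrSupport (ν : Measure (Pop n)) : IsClosed (instrSupport ν) :=
  Measure.isClosed_support

/-- If two continuous versions differ at a point of the support, they differ on a relatively open
neighbourhood of it, which has positive probability; but they agree almost surely. -/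
theorem IsRegression.eqOn {ν : Measure (Pop n)} {W : Pop n → ℝ} {m m' : Sph n × ℝ → ℝ}
    (h : IsRegression ν W m) (h' : IsRegression ν W m') : EqOn m m' (instrSupport ν) := by
  intro p hp
  by_contra hne
  have hc := ((h.1 p hp).sub (h'.1 p hp)).eventually_ne (sub_ne_zero.mpr hne)
  obtain ⟨U, hU, hpU, hUs⟩ := mem_nhdsWithin.mp hc
  have hpos := (Measure.mem_support_iff_forall p).mp hp U (hU.mem_nhds hpU)
  rw [Measure.map_apply measurable_instr hU.measurableSet] at hpos
  refine hpos.ne' ?_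
  have hae : ∀ᵐ w ∂ν, instr w ∉ U := by
    filter_upwards [h.2, h'.2, ae_instr_mem ν] with w h1 h2 h3 h4
    exact hUs ⟨h4, h3⟩ (sub_eq_zero.mpr (h1.trans h2.symm))
  rw [ae_iff] at hae
  simp only [not_not] at hae
  exact hae

theorem IsRegression.eqOn_regression {ν : Measure (Pop n)} {W : Pop n → ℝ} {m : Sph n × ℝ → ℝ}
    (h : IsRegression ν W m) : EqOn (regression ν W) m (instrSupport ν) := by
  have hex : ∃ m, IsRegression ν W m := ⟨m, h⟩
  rw [regression, dif_pos hex]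
  exact hex.choose_spec.eqOn h

/-- At an accumulation point of the support in the `v` direction, the derivative within the support
equals the full derivative `R[G]`. Elsewhere `R[G]` vanishes by `hacc`, and so does `dReg`. -/
theorem isRadonInverse_dReg {ν : Measure (Pop n)} {W : Pop n → ℝ} {G : Euc (n + 1) → ℝ} {c : ℝ}
    (hG : Integrable G) (hGm : StronglyMeasurable G)
    (hm : IsRegression ν W fun p => c + halfMass G p.1 p.2)
    (hacc : ∀ᵐ p ∂(((sphMeasure n).restrict (upper n)).prod (volume : Measure ℝ)),
      deriv (halfMass G p.1) p.2 ≠ 0 →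
        AccPt p.2 (Filter.principal {v | (p.1, v) ∈ instrSupport ν})) :
    IsRadonInverse (dReg ν W) G := by
  have : IsFiniteMeasure (sphMeasure n) :=
    inferInstanceAs (IsFiniteMeasure (volume : Measure (Euc (n + 1))).toSphere)
  refine ⟨hG, ?_⟩
  filter_upwards [hacc, ae_prod_hasDerivAt_halfMass hG hGm _] with ⟨s, u⟩ ha hd
  simp only at ha hd ⊢
  have hcl : IsClosed {v | (s, v) ∈ instrSupport ν} :=
    (isClosed_instrSupport ν).preimage (f := fun v : ℝ => (s, v)) (by fun_prop)
  have hreg : EqOn (fun v => regression ν W (s, v)) (fun v => c + halfMass G s v)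
      {v | (s, v) ∈ instrSupport ν} := fun v hv => hm.eqOn_regression hv
  by_cases hA : AccPt u (Filter.principal {v | (s, v) ∈ instrSupport ν})
  · have hmem : (s, u) ∈ instrSupport ν := by
      have := hA.clusterPt.mem_closure
      rwa [hcl.closure_eq] at this
    rw [dReg, if_pos hmem]
    have hdw := ((hd.const_add c).hasDerivWithinAt (s := {v | (s, v) ∈ instrSupport ν})).congr
      hreg (hreg hmem)
    exact (hdw.derivWithin hA.uniqueDiffWithinAt).symm
  · have h0 : deriv (halfMass G s) u = 0 := by
      by_contra h; exact hA (ha h)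
    rw [hd.deriv] at h0
    rw [h0, dReg]
    -- An isolated point of the section may still lie in the support; there `derivWithin` has the
    -- default value `0`.
    split_ifs
    · rw [derivWithin_zero_of_not_accPt hA]
    · rfl

/-! ### Consequences of the large support condition -/

theorem AbsCont.map_tG {ν : Measure (Pop n)} (h : AbsCont ν) :
    ν.map tG ≪ (volume : Measure (Euc (n + 1))) := by
  have : IsFiniteMeasure (sphMeasure n) :=
    inferInstanceAs (IsFiniteMeasure (volume : Measure (Euc (n + 1))).toSphere)
  have hm : Measurable fun w : Pop n => (tS w, tV w, tG w) :=
    measurable_tS.prodMk (measurable_tV.prodMk measurable_tG)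
  have hq : Measure.QuasiMeasurePreserving (fun p : Sph n × ℝ × Euc (n + 1) => p.2.2)
      ((sphMeasure n).prod ((volume : Measure ℝ).prod (volume : Measure (Euc (n + 1))))) volume :=
    Measure.quasiMeasurePreserving_snd.comp Measure.quasiMeasurePreserving_snd
  have h1 := (hq.mono_left h).absolutelyContinuous
  rwa [Measure.map_map (by fun_prop) hm] at h1

/-- `G` vanishes almost everywhere on the sets which are null for `μ`. -/
def VanishesOnNull (μ : Measure (Euc (n + 1))) (G : Euc (n + 1) → ℝ) : Prop :=
  ∀ B, MeasurableSet B → μ B = 0 → ∀ᵐ γ, γ ∈ B → G γ = 0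

/-- By disintegration, for almost every `s` the closed `s`-section of the joint support has full
conditional measure, so it contains the conditional support. -/
theorem prod_support_subset_instrSupport (ν : Measure (Pop n)) [IsFiniteMeasure ν] :
    ∀ᵐ s : Sph n ∂(ν.map tS), ∀ v ∈ (condDistrib tV tS ν s).support, (s, v) ∈ instrSupport ν := by
  have h1 : ∀ᵐ p ∂(ν.map instr), p ∈ instrSupport ν :=
    mem_ae_iff.mpr Measure.measure_compl_support
  have h2 : ν.map instr = (ν.map tS) ⊗ₘ condDistrib tV tS ν :=
    (compProd_map_condDistrib measurable_tV.aemeasurable).symm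
  rw [h2] at h1
  filter_upwards [Measure.ae_ae_of_ae_compProd h1] with s hs v hv
  have hcl : IsClosed {v | (s, v) ∈ instrSupport ν} :=
    (isClosed_instrSupport ν).preimage (f := fun v : ℝ => (s, v)) (by fun_prop)
  exact Measure.support_subset_of_isClosed hcl hs hv

/-- The pairs `(s, u)` such that `u` lies strictly between two values of `s'γ` for `γ ∈ T`. -/
def between (T : Set (Euc (n + 1))) : Set (Sph n × ℝ) :=
  {p | ∃ γ₁ ∈ T, ∃ γ₂ ∈ T, inner ℝ (p.1 : Euc (n + 1)) γ₁ < p.2 ∧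
    p.2 < inner ℝ (p.1 : Euc (n + 1)) γ₂}

theorem isOpen_between (T : Set (Euc (n + 1))) : IsOpen (between T) := by
  have : between T = ⋃ γ₁ ∈ T, ⋃ γ₂ ∈ T, {p | inner ℝ (p.1 : Euc (n + 1)) γ₁ < p.2} ∩
      {p | p.2 < inner ℝ (p.1 : Euc (n + 1)) γ₂} := by
    ext p; simp only [between, mem_iUnion, mem_inter_iff, mem_ofPred_eq, exists_prop]
  rw [this]
  refine isOpen_biUnion fun γ₁ _ => isOpen_biUnion fun γ₂ _ => ?_
  exact (isOpen_lt (by fun_prop) (by fun_prop)).inter (isOpen_lt (by fun_prop) (by fun_prop))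

/-- Large support speaks only of almost every `s`. As `between` is open and the support of the
instruments is closed, good directions `r` arbitrarily near `s` extend the inclusion to every `s ∈
H⁺`. -/
theorem between_subset_instrSupport {ν : Measure (Pop n)} [IsFiniteMeasure ν]
    (hS : LargeSupport ν) (hn : 1 ≤ n) {s : Sph n} (hs : s ∈ upper n) {u : ℝ}
    (hu : (s, u) ∈ between (ν.map tG).support) : (s, u) ∈ instrSupport ν := by
  obtain ⟨h1, h2⟩ := hS.2 hn
  rw [← (isClosed_instrSupport ν).closure_eq]
  rw [mem_closure_iff_nhds]
  intro N hN
  have hpre : {r : Sph n | (r, u) ∈ N ∩ between (ν.map tG).support} ∈ nhds s :=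
    (Continuous.continuousAt (f := fun r : Sph n => (r, u)) (by fun_prop)).preimage_mem_nhds
      (Filter.inter_mem hN ((isOpen_between _).mem_nhds hu))
  have hpos := (Measure.mem_support_iff_forall s).mp (h1 ▸ subset_closure hs) _ hpre
  obtain ⟨r, hr, hr1, hr2⟩ : ∃ r, r ∈ {r : Sph n | (r, u) ∈ N ∩ between (ν.map tG).support} ∧ _ ∧ _ :=
    ((frequently_ae_mem_iff.mpr hpos.ne').and_eventually
      (h2.and (prod_support_subset_instrSupport ν))).exists
  refine ⟨(r, u), hr.1, hr2 u (hr1 ?_)⟩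
  obtain ⟨γ₁, hγ₁, γ₂, hγ₂, hl, hg⟩ := hr.2
  exact ⟨(iInf₂_le γ₁ hγ₁).trans (EReal.coe_le_coe_iff.mpr hl.le),
    (EReal.coe_le_coe_iff.mpr hg.le).trans
      (le_iSup₂ (f := fun γ _ => ((inner ℝ (r : Euc (n + 1)) γ : ℝ) : EReal)) γ₂ hγ₂)⟩

theorem accPt_of_isOpen_subset {U C : Set ℝ} (hU : IsOpen U) (h : U ⊆ C) {u : ℝ} (hu : u ∈ U) :
    AccPt u (Filter.principal C) := by
  have : AccPt u (Filter.principal (univ : Set ℝ)) := by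
    rw [Filter.principal_univ, AccPt, inf_top_eq]; infer_instance
  have h2 := this.nhds_inter (hU.mem_nhds hu)
  exact h2.mono (Filter.principal_mono.mpr (by simpa using h))

theorem VanishesOnNull.ae_support {μ : Measure (Euc (n + 1))} {G : Euc (n + 1) → ℝ}
    (hG : VanishesOnNull μ G) : ∀ᵐ γ, γ ∉ μ.support → G γ = 0 :=
  hG _ Measure.isClosed_support.measurableSet.compl Measure.measure_compl_support

theorem accPt_of_deriv_ne_zero_of_one_le {ν : Measure (Pop n)} [IsFiniteMeasure ν]
    (hS : LargeSupport ν) (hn : 1 ≤ n) {G : Euc (n + 1) → ℝ} (hGi : Integrable G)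
    (hG : VanishesOnNull (ν.map tG) G) :
    ∀ᵐ p ∂(((sphMeasure n).restrict (upper n)).prod (volume : Measure ℝ)),
      deriv (halfMass G p.1) p.2 ≠ 0 →
        AccPt p.2 (Filter.principal {v | (p.1, v) ∈ instrSupport ν}) := by
  have : IsFiniteMeasure (sphMeasure n) :=
    inferInstanceAs (IsFiniteMeasure (volume : Measure (Euc (n + 1))).toSphere)
  set T := (ν.map tG).support with hT
  have hc : Continuous (Function.uncurry fun (s : Sph n) (v : ℝ) => halfMass G s v) :=
    continuous_halfMass hGi
  have hm : MeasurableSet {p : Sph n × ℝ | deriv (halfMass G p.1) p.2 ≠ 0 → p ∈ between T} := by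
    have h1 : MeasurableSet {p : Sph n × ℝ | deriv (halfMass G p.1) p.2 = 0} :=
      measurableSet_eq_fun (measurable_deriv_with_param hc) measurable_const
    convert! h1.union (isOpen_between T).measurableSet using 1
    ext p
    simp only [ne_eq, mem_ofPred_eq, mem_union]
    tauto
  have hb : ∀ᵐ p ∂(((sphMeasure n).restrict (upper n)).prod (volume : Measure ℝ)),
      deriv (halfMass G p.1) p.2 ≠ 0 → p ∈ between T := by
    refine (Measure.ae_prod_iff_ae_ae hm).mpr (.of_forall fun s => ?_)
    -- A point outside `between T` lies weakly below or weakly above all the values `s'γ`. Strictly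
    -- beyond an extreme value the half-space integral is locally constant, so each of `A` and `B`
    -- has at most one point.
    let A : Set ℝ := {u | deriv (halfMass G s) u ≠ 0 ∧ ∀ γ ∈ T, u ≤ inner ℝ (s : Euc (n + 1)) γ}
    let B : Set ℝ := {u | deriv (halfMass G s) u ≠ 0 ∧ ∀ γ ∈ T, inner ℝ (s : Euc (n + 1)) γ ≤ u}
    have hA : A.Subsingleton := by
      have key : ∀ u ∈ A, ∀ u' ∈ A, ¬ u < u' := by
        intro u hu u' hu' hlt
        refine hu.1 (deriv_halfMass_eq_zero (a := u - 1) (b := u') ⟨by linarith, hlt⟩ ?_)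
        filter_upwards [hG.ae_support] with γ hγ hmem
        exact hγ fun hγT => absurd hmem.2 (not_lt.mpr (hu'.2 γ hγT))
      intro u hu u' hu'
      exact le_antisymm (not_lt.mp (key _ hu' _ hu)) (not_lt.mp (key _ hu _ hu'))
    have hB : B.Subsingleton := by
      have key : ∀ u ∈ B, ∀ u' ∈ B, ¬ u < u' := by
        intro u hu u' hu' hlt
        refine hu'.1 (deriv_halfMass_eq_zero (a := u) (b := u' + 1) ⟨hlt, by linarith⟩ ?_)
        filter_upwards [hG.ae_support] with γ hγ hmem
        exact hγ fun hγT => absurd hmem.1 (not_lt.mpr (hu.2 γ hγT))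
      intro u hu u' hu'
      exact le_antisymm (not_lt.mp (key _ hu' _ hu)) (not_lt.mp (key _ hu _ hu'))
    refine measure_mono_null (t := A ∪ B) ?_
      (measure_union_null (hA.measure_zero volume) (hB.measure_zero volume))
    intro u hu
    simp only [mem_compl_iff, mem_ofPred_eq, not_forall] at hu
    obtain ⟨hd, hnb⟩ := hu
    by_contra hAB
    simp only [A, B, mem_union, mem_ofPred_eq, not_or, not_and, not_forall, not_le] at hAB
    obtain ⟨γ₁, h1, h1'⟩ := hAB.1 hd
    obtain ⟨γ₂, h2, h2'⟩ := hAB.2 hd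
    exact hnb ⟨γ₁, h1, γ₂, h2, h1', h2'⟩
  have hup : ∀ᵐ p ∂(((sphMeasure n).restrict (upper n)).prod (volume : Measure ℝ)),
      p.1 ∈ upper n := by
    have hmu : MeasurableSet (upper n) := by
      unfold upper
      exact (isOpen_lt continuous_const (by fun_prop)).measurableSet
    exact Measure.quasiMeasurePreserving_fst.ae (ae_restrict_mem hmu)
  filter_upwards [hb, hup] with p hp hpu hd
  refine accPt_of_isOpen_subset (U := {v | (p.1, v) ∈ between T})
    ((isOpen_between T).preimage (f := fun v : ℝ => (p.1, v)) (by fun_prop)) ?_ (hp hd)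
  exact fun v hv => between_subset_instrSupport hS hn hpu hv

theorem eq_north {s : Sph 0} (hs : s ∈ upper 0) : s = north 0 := by
  have h1 := norm_sph s
  rw [EuclideanSpace.norm_eq, Real.sqrt_eq_one] at h1
  simp only [Fin.sum_univ_succ, Fin.sum_univ_zero, Real.norm_eq_abs, sq_abs, add_zero,
    upper, mem_ofPred_eq, Fin.last_zero] at h1 hs
  have h2 : (s : Euc 1) 0 = 1 := by nlinarith
  refine Subtype.ext ?_
  ext i
  have hi : i = 0 := Fin.fin_one_eq_zero i
  subst hi
  simp [north, h2]

theorem inner_north (γ : Euc (n + 1)) :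
    inner ℝ (north n : Euc (n + 1)) γ = γ (Fin.last n) := by
  simp [north, EuclideanSpace.inner_single_left]

theorem icept_eq (w : Pop n) : icept w = inner ℝ (north n : Euc (n + 1)) (tG w) := by
  rw [inner_north]; simp [tG, append]

/-- For `L = 1` the set `H⁺` is a single point. A nonzero derivative at `u` forces `u` into the
support of `Θ`; absolute continuity excludes an atom at `u`, so `u` is an accumulation point of that
support, hence of the support of `V`. -/
theorem accPt_of_deriv_ne_zero_of_eq_zero {ν : Measure (Pop 0)} [IsFiniteMeasure ν]
    (hS : LargeSupport ν) (hAC : ν.map tG ≪ (volume : Measure (Euc (0 + 1))))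
    {G : Euc (0 + 1) → ℝ} (hG : VanishesOnNull (ν.map tG) G) {s : Sph 0} (hs : s ∈ upper 0) {u : ℝ}
    (hd : deriv (halfMass G s) u ≠ 0) :
    AccPt u (Filter.principal {v | (s, v) ∈ instrSupport ν}) := by
  obtain rfl := eq_north hs
  have hT : u ∈ (ν.map icept).support := by
    by_contra hu
    obtain ⟨N, hN, hN0⟩ := Measure.notMem_support_iff_exists.mp hu
    obtain ⟨a, b, hab, hsub⟩ := mem_nhds_iff_exists_Ioo_subset.mp hN
    refine hd (deriv_halfMass_eq_zero hab ?_)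
    have hmB : Measurable fun γ : Euc (0 + 1) => inner ℝ (north 0 : Euc (0 + 1)) γ := by fun_prop
    refine hG ((fun γ => inner ℝ (north 0 : Euc (0 + 1)) γ) ⁻¹' Ioo a b) (hmB measurableSet_Ioo) ?_
    rw [Measure.map_apply measurable_tG (hmB measurableSet_Ioo)]
    have h0 := measure_mono_null hsub hN0
    rw [Measure.map_apply measurable_icept measurableSet_Ioo] at h0
    convert! h0 using 2
    ext w
    simp [icept_eq]
  have hatom : ν.map icept {u} = 0 := by
    have h1 := ae_of_ae_map measurable_tG.aemeasurable (hAC.ae_le (ae_inner_ne (north 0) u))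
    rw [Measure.map_apply measurable_icept (measurableSet_singleton u)]
    rw [ae_iff] at h1
    simp only [not_not] at h1
    convert! h1 using 2
    ext w
    simp [icept_eq]
  have hsub : (ν.map icept).support ⊆ {v | (north 0, v) ∈ instrSupport ν} := by
    intro v hv
    have hv := hS.1 rfl hv
    refine (Measure.mem_support_iff_forall _).mpr fun U hU => ?_
    have hpre : (fun r : ℝ => (north 0, r)) ⁻¹' U ∈ nhds v :=
      (Continuous.continuousAt (by fun_prop)).preimage_mem_nhds hU
    have hpos := (Measure.mem_support_iff_forall v).mp hv _ hpre
    refine hpos.trans_le ?_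
    have hle : ν.map instr = (ν.map instrV).map fun r => (north 0, r) := by
      rw [Measure.map_map (by fun_prop) measurable_instrV]
      congr 1
      ext1 w
      have h1 : tS w = north 0 := eq_north (direction_mem_upper _)
      have h2 : ‖append (instrZ w) 1‖ = 1 := by
        rw [EuclideanSpace.norm_eq, Real.sqrt_eq_one, Fin.sum_univ_castSucc]
        simp only [append, Fin.snoc_last]
        simp
      simp [instr, h1, tV, h2]
    rw [hle]
    exact Measure.le_map_apply (by fun_prop) U
  rw [accPt_iff_nhds]
  intro U hU
  have hpos := (Measure.mem_support_iff_forall u).mp hT U hU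
  have hpos' : 0 < ν.map icept (U \ {u}) := by rwa [measure_sdiff_null hatom]
  obtain ⟨v, hv, hvs⟩ := Measure.nonempty_inter_support_of_pos hpos'
  exact ⟨v, ⟨hv.1, hsub hvs⟩, hv.2⟩

theorem accPt_of_deriv_ne_zero {ν : Measure (Pop n)} [IsFiniteMeasure ν]
    (hS : LargeSupport ν) (hAC : AbsCont ν) {G : Euc (n + 1) → ℝ} (hGi : Integrable G)
    (hG : VanishesOnNull (ν.map tG) G) :
    ∀ᵐ p ∂(((sphMeasure n).restrict (upper n)).prod (volume : Measure ℝ)),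
      deriv (halfMass G p.1) p.2 ≠ 0 →
        AccPt p.2 (Filter.principal {v | (p.1, v) ∈ instrSupport ν}) := by
  rcases Nat.eq_zero_or_pos n with rfl | hn
  · have : IsFiniteMeasure (sphMeasure 0) :=
      inferInstanceAs (IsFiniteMeasure (volume : Measure (Euc (0 + 1))).toSphere)
    have hmu : MeasurableSet (upper 0) := by
      unfold upper
      exact (isOpen_lt continuous_const (by fun_prop)).measurableSet
    filter_upwards [Measure.quasiMeasurePreserving_fst.ae (ae_restrict_mem hmu)] with p hp hd
    exact accPt_of_deriv_ne_zero_of_eq_zero hS hAC.map_tG hG hp hd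
  · exact accPt_of_deriv_ne_zero_of_one_le hS hn hGi hG

/-! ### Conditional expectations and independence -/

theorem condExp_of_indepFun {α β γ : Type*} [MeasurableSpace α] [MeasurableSpace β]
    [MeasurableSpace γ] [StandardBorelSpace γ] [Nonempty γ] {μ : Measure α} [IsFiniteMeasure μ]
    {X : α → β} {Y : α → γ} (hX : Measurable X) (hY : Measurable Y) (hXY : IndepFun X Y μ)
    {f : β × γ → ℝ} (hf : StronglyMeasurable f) (hi : Integrable (fun a => f (X a, Y a)) μ) :
    μ[fun a => f (X a, Y a) | MeasurableSpace.comap X inferInstance] =ᵐ[μ]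
      fun a => ∫ a', f (X a, Y a') ∂μ := by
  have h1 : condDistrib Y X μ =ᵐ[μ.map X] Kernel.const β (μ.map Y) := by
    refine condDistrib_ae_eq_of_measure_eq_compProd X hY.aemeasurable ?_
    rw [Measure.compProd_const]
    exact (indepFun_iff_map_prod_eq_prod_map_map hX.aemeasurable hY.aemeasurable).mp hXY
  filter_upwards [condExp_prod_ae_eq_integral_condDistrib hX hY.aemeasurable hf hi,
    ae_of_ae_map hX.aemeasurable h1] with a ha ha'
  rw [ha, ha', Kernel.const_apply, integral_map hY.aemeasurable]
  exact (hf.comp_measurable measurable_prodMk_left).aestronglyMeasurable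

/-! ### The density of the latent variables weighted by a function of the outcomes -/

/-- The density of `Γ̃`. -/
def latentDensity (ν : Measure (Pop n)) (γ : Euc (n + 1)) : ℝ :=
  ((ν.map tG).rnDeriv volume γ).toReal

/-- The conditional distribution of `(Y₀, Y₁)` given `Γ̃`. -/
def outcomeKernel (ν : Measure (Pop n)) [IsFiniteMeasure ν] : Kernel (Euc (n + 1)) (ℝ × ℝ) :=
  condDistrib (fun w => (y0 w, y1 w)) tG ν

instance (ν : Measure (Pop n)) [IsFiniteMeasure ν] : IsMarkovKernel (outcomeKernel ν) := by
  unfold outcomeKernel; infer_instance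

/-- `f_Γ̃(γ) E[a(Y₀, Y₁) | Γ̃ = γ]`. -/
def weightedDensity (ν : Measure (Pop n)) [IsFiniteMeasure ν] (a : ℝ × ℝ → ℝ)
    (γ : Euc (n + 1)) : ℝ :=
  latentDensity ν γ * ∫ p, a p ∂(outcomeKernel ν γ)

theorem latentDensity_nonneg (ν : Measure (Pop n)) (γ : Euc (n + 1)) : 0 ≤ latentDensity ν γ :=
  ENNReal.toReal_nonneg

theorem measurable_outcomes : Measurable fun w : Pop n => (y0 w, y1 w) :=
  measurable_y0.prodMk measurable_y1

theorem integrable_map_pair {ν : Measure (Pop n)} {a : ℝ × ℝ → ℝ} (ha : Measurable a) (hi : Integrable (fun w => a (y0 w, y1 w)) ν)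
    {φ : Euc (n + 1) → ℝ} (hφ : Measurable φ) (hb : ∀ γ, ‖φ γ‖ ≤ 1) :
    Integrable (fun q : Euc (n + 1) × ℝ × ℝ => a q.2 * φ q.1)
      (ν.map fun w => (tG w, y0 w, y1 w)) := by
  rw [integrable_map_measure (by fun_prop)
    (measurable_tG.prodMk measurable_outcomes).aemeasurable]
  exact hi.mul_bdd (c := 1) (hφ.comp measurable_tG).aestronglyMeasurable (.of_forall fun w => hb _)

section

variable {ν : Measure (Pop n)} [IsFiniteMeasure ν] {a : ℝ × ℝ → ℝ}

theorem stronglyMeasurable_weightedDensity (ha : Measurable a) :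
    StronglyMeasurable (weightedDensity ν a) := by
  refine (Measure.measurable_rnDeriv _ _).ennreal_toReal.stronglyMeasurable.mul ?_
  exact StronglyMeasurable.integral_kernel_prod_right (κ := outcomeKernel ν)
    (f := fun _ p => a p) (ha.comp measurable_snd).stronglyMeasurable

theorem integrable_weightedDensity (hAC : ν.map tG ≪ (volume : Measure (Euc (n + 1))))
    (ha : Measurable a) (hi : Integrable (fun w => a (y0 w, y1 w)) ν) :
    Integrable (weightedDensity ν a) := by
  have h := integrable_map_pair ha hi (φ := fun _ => 1) measurable_const (by simp)
  have h2 := h.integral_condDistrib_map measurable_outcomes.aemeasurable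
  simp only [mul_one] at h2
  exact (integrable_rnDeriv_smul_iff hAC).mpr h2

/-- Disintegrate the law of `(Γ̃, Y₀, Y₁)` over `Γ̃`, then write the law of `Γ̃` through its
density. Taking `φ` to be a half-space indicator links `halfMass` to the regression function. -/
theorem integral_weightedDensity_mul (hAC : ν.map tG ≪ (volume : Measure (Euc (n + 1))))
    (ha : Measurable a) (hi : Integrable (fun w => a (y0 w, y1 w)) ν)
    {φ : Euc (n + 1) → ℝ} (hφ : Measurable φ) (hb : ∀ γ, ‖φ γ‖ ≤ 1) :
    ∫ γ, weightedDensity ν a γ * φ γ = ∫ w, a (y0 w, y1 w) * φ (tG w) ∂ν := by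
  have h := integrable_map_pair ha hi hφ hb
  have h1 : ∫ w, a (y0 w, y1 w) * φ (tG w) ∂ν =
      ∫ q, a q.2 * φ q.1 ∂(ν.map fun w => (tG w, y0 w, y1 w)) := by
    rw [integral_map (measurable_tG.prodMk measurable_outcomes).aemeasurable h.1]
  have h2 := compProd_map_condDistrib (μ := ν) (X := tG) (mβ := inferInstance)
    measurable_outcomes.aemeasurable
  rw [h1, ← h2, Measure.integral_compProd (by rwa [h2]), ← integral_rnDeriv_smul hAC]
  refine integral_congr_ae (.of_forall fun γ => ?_)
  simp only [integral_mul_const, weightedDensity, latentDensity, outcomeKernel, smul_eq_mul]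
  ring

theorem integral_weightedDensity (hAC : ν.map tG ≪ (volume : Measure (Euc (n + 1))))
    (ha : Measurable a) (hi : Integrable (fun w => a (y0 w, y1 w)) ν) :
    ∫ γ, weightedDensity ν a γ = ∫ w, a (y0 w, y1 w) ∂ν := by
  simpa using integral_weightedDensity_mul hAC ha hi (φ := fun _ => 1) measurable_const (by simp)

theorem halfMass_weightedDensity (hAC : ν.map tG ≪ (volume : Measure (Euc (n + 1))))
    (ha : Measurable a) (hi : Integrable (fun w => a (y0 w, y1 w)) ν) (s : Sph n) (v : ℝ) :
    halfMass (weightedDensity ν a) s v =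
      ∫ w, a (y0 w, y1 w) * (Iio v).indicator (fun _ => 1) (inner ℝ (s : Euc (n + 1)) (tG w)) ∂ν := by
  rw [← integral_weightedDensity_mul hAC ha hi (measurable_indicator_Iio_inner s v)
    fun γ => (norm_indicator_le_norm_self _ _).trans (by simp)]
  simp only [halfMass, indicator_Iio_smul, smul_eq_mul]

theorem vanishesOnNull_weightedDensity (hAC : ν.map tG ≪ (volume : Measure (Euc (n + 1)))) :
    VanishesOnNull (ν.map tG) (weightedDensity ν a) := by
  intro B hB h0
  rw [← Measure.setLIntegral_rnDeriv' hAC hB,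
    lintegral_eq_zero_iff (Measure.measurable_rnDeriv _ _)] at h0
  have h1 := (ae_restrict_iff' hB).mp h0
  filter_upwards [h1] with γ hγ hm
  simp [weightedDensity, latentDensity, hγ hm]

end

/-! ### Identification -/

theorem measurableSet_below :
    MeasurableSet {q : (Sph n × ℝ) × ℝ × Euc (n + 1) |
      inner ℝ (q.1.1 : Euc (n + 1)) q.2.2 < q.1.2} :=
  measurableSet_lt (by fun_prop) (by fun_prop)

/-- `U` stands for one potential outcome. Treatment depends only on the instruments and on `Γ̃`, so
conditioning on the instruments freezes the half-space and leaves the law of `(U, Γ̃)` unchanged. -/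
theorem condExp_treat_mul {ν : Measure (Pop n)} [IsFiniteMeasure ν] {U : Pop n → ℝ}
    (hU : Measurable U)
    (hind : IndepFun (fun w => (instrV w, instrZ w)) (fun w => (U w, slope w, icept w)) ν)
    {a : ℝ → ℝ} (ha : Measurable a) (hi : Integrable (fun w => a (U w)) ν) :
    ν[fun w => treat w * a (U w) | MeasurableSpace.comap instr inferInstance] =ᵐ[ν]
      (fun w => ∫ w', a (U w') *
        (Iio (tV w)).indicator (fun _ => 1) (inner ℝ (tS w : Euc (n + 1)) (tG w')) ∂ν) ∧
    ν[fun w => a (U w) | MeasurableSpace.comap instr inferInstance] =ᵐ[ν]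
      fun _ => ∫ w', a (U w') ∂ν := by
  have hind' : IndepFun instr (fun w => (U w, tG w)) ν := by
    have h := hind.comp (φ := normalize) (ψ := fun q => (q.1, append q.2.1 q.2.2))
      measurable_normalize (measurable_fst.prodMk (measurable_append.comp measurable_snd))
    convert! h using 1
  have hUG : Measurable fun w => (U w, tG w) := hU.prodMk measurable_tG
  constructor
  · let f : (Sph n × ℝ) × ℝ × Euc (n + 1) → ℝ := fun q =>
      a q.2.1 * (Iio q.1.2).indicator (fun _ => 1) (inner ℝ (q.1.1 : Euc (n + 1)) q.2.2)
    have hf : Measurable f := by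
      have : f = {q : (Sph n × ℝ) × ℝ × Euc (n + 1) |
          inner ℝ (q.1.1 : Euc (n + 1)) q.2.2 < q.1.2}.indicator fun q => a q.2.1 := by
        ext q
        simp only [f, indicator, mem_Iio, mem_ofPred_eq, mul_ite, mul_one, mul_zero]
      rw [this]
      exact (ha.comp (by fun_prop)).indicator measurableSet_below
    have he : (fun w => treat w * a (U w)) = fun w => f (instr w, U w, tG w) := by
      ext w
      rw [treat_eq, mul_comm]
      rfl
    have hint : Integrable (fun w => f (instr w, U w, tG w)) ν := by
      refine hi.mono (hf.comp (measurable_instr.prodMk hUG)).aestronglyMeasurable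
        (.of_forall fun w => ?_)
      simp only [f, norm_mul]
      exact mul_le_of_le_one_right (norm_nonneg _)
        ((norm_indicator_le_norm_self _ _).trans (by simp))
    rw [he]
    exact condExp_of_indepFun measurable_instr hUG hind' hf.stronglyMeasurable hint
  · exact condExp_of_indepFun measurable_instr hUG hind' (f := fun q => a q.2.1)
      (ha.comp (by fun_prop)).stronglyMeasurable hi

theorem measurable_treat : Measurable (treat : Pop n → ℝ) := by
  refine Measurable.ite (measurableSet_lt measurable_const ?_) measurable_const measurable_const
  exact (measurable_instrV.sub (measurable_instrZ.inner measurable_slope)).sub measurable_icept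

theorem integrable_treat_mul {ν : Measure (Pop n)} {W : Pop n → ℝ} (hi : Integrable W ν) :
    Integrable (fun w => treat w * W w) ν := by
  refine hi.bdd_mul (c := 1) measurable_treat.aestronglyMeasurable (.of_forall fun w => ?_)
  simp only [treat]
  split_ifs <;> simp

/-- The conditions on the conditional distribution given `X = x` under which the distribution of
the latent variables is identified. -/
structure Regular (ν : Measure (Pop n)) [IsFiniteMeasure ν] : Prop where
  absCont : AbsCont ν
  exogenous : Exogenous ν
  largeSupport : LargeSupport ν

/-- The inverse Radon transform of the derivative of the regression function of
`D a(Y₁) + (1 - D) b(Y₀)` is `γ ↦ f_Γ̃(γ) E[a(Y₁) - b(Y₀) | Γ̃ = γ]`. -/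
theorem Regular.identification {ν : Measure (Pop n)} [IsFiniteMeasure ν] (h : Regular ν)
    {a b : ℝ → ℝ} (ha : Measurable a) (hb : Measurable b)
    (hai : Integrable (fun w => a (y1 w)) ν) (hbi : Integrable (fun w => b (y0 w)) ν)
    {W : Pop n → ℝ} (hW : ∀ w, W w = treat w * a (y1 w) + (1 - treat w) * b (y0 w)) :
    (∃ m, IsRegression ν W m) ∧
      IsRadonInverse (dReg ν W) (weightedDensity ν fun p => a p.2 - b p.1) := by
  set A : ℝ × ℝ → ℝ := fun p => a p.2 - b p.1 with hA
  have hAm : Measurable A := by fun_prop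
  have hAi : Integrable (fun w => A (y0 w, y1 w)) ν := hai.sub hbi
  have hAC := h.absCont.map_tG
  have hGi := integrable_weightedDensity hAC hAm hAi
  set G := weightedDensity ν A
  have hreg : IsRegression ν W fun p => (∫ w, b (y0 w) ∂ν) + halfMass G p.1 p.2 := by
    refine ⟨(continuous_const.add (continuous_halfMass hGi)).continuousOn, ?_⟩
    have e1 := condExp_treat_mul measurable_y1 h.exogenous.2 ha hai
    have e0 := condExp_treat_mul measurable_y0 h.exogenous.1 hb hbi
    -- Each term involves only one potential outcome, as the instruments are not assumed independent
    -- of `(Y₀, Y₁, Γ̃)` jointly.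
    have hWe : W = (fun w => treat w * a (y1 w)) - (fun w => treat w * b (y0 w)) +
        fun w => b (y0 w) := by
      ext w; simp only [hW, Pi.add_apply, Pi.sub_apply]; ring
    have hs := condExp_add (μ := ν) ((integrable_treat_mul hai).sub (integrable_treat_mul hbi)) hbi
      (MeasurableSpace.comap instr inferInstance)
    have hd := condExp_sub (μ := ν) (integrable_treat_mul hai) (integrable_treat_mul hbi)
      (MeasurableSpace.comap instr inferInstance)
    rw [hWe]
    filter_upwards [e1.1, e0.1, e0.2, hs, hd] with w h1 h2 h3 h4 h5
    rw [h4, Pi.add_apply, h5, Pi.sub_apply, h1, h2, h3, halfMass_weightedDensity hAC hAm hAi]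
    simp only [hA, sub_mul]
    have hind (c : Pop n → ℝ) (hc : Integrable c ν) : Integrable (fun w' => c w' *
        (Iio (tV w)).indicator (fun _ => (1 : ℝ)) (inner ℝ (tS w : Euc (n + 1)) (tG w'))) ν :=
      hc.mul_bdd (c := 1) ((measurable_indicator_Iio_inner (tS w) (tV w)).comp
        measurable_tG).aestronglyMeasurable
        (.of_forall fun w' => (norm_indicator_le_norm_self _ _).trans (by simp))
    simp only [instr]
    rw [integral_sub (hind _ hai) (hind _ hbi)]
    ring
  exact ⟨⟨_, hreg⟩, isRadonInverse_dReg hGi (stronglyMeasurable_weightedDensity hAm) hreg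
    (accPt_of_deriv_ne_zero h.largeSupport h.absCont hGi (vanishesOnNull_weightedDensity hAC))⟩

theorem Regular.identified {ν : Measure (Pop n)} [IsFiniteMeasure ν] (h : Regular ν)
    {a b : ℝ → ℝ} (ha : Measurable a) (hb : Measurable b)
    (hai : Integrable (fun w => a (y1 w)) ν) (hbi : Integrable (fun w => b (y0 w)) ν)
    {W : Pop n → ℝ} (hW : ∀ w, W w = treat w * a (y1 w) + (1 - treat w) * b (y0 w)) :
    Identified ν W ∧ ∫ γ, ident ν W γ = (∫ w, a (y1 w) ∂ν) - ∫ w, b (y0 w) ∂ν := by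
  obtain ⟨h1, h2⟩ := h.identification ha hb hai hbi hW
  refine ⟨⟨h1, _, h2⟩, ?_⟩
  rw [ident, integral_congr_ae (radonInv_ae_eq h2),
    integral_weightedDensity h.absCont.map_tG (by fun_prop) (hai.sub hbi), integral_sub hai hbi]

/-! ### Families which are right-continuous in the threshold -/

theorem eq_zero_of_rightContinuous {g : ℝ → ℝ} (hg : ∀ y, ContinuousWithinAt g (Ici y) y)
    (h : ∀ q : ℚ, g q = 0) (y : ℝ) : g y = 0 := by
  by_contra hne
  obtain ⟨b, hb, hsub⟩ := (mem_nhdsGE_iff_exists_Ico_subset).mp ((hg y).eventually_ne hne)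
  obtain ⟨q, hq1, hq2⟩ := exists_rat_btwn (mem_Ioi.mp hb)
  exact hsub ⟨hq1.le, hq2⟩ (h q)

/-- This replaces the supremum over all real thresholds by a countable one, which is measurable in
`γ`. -/
theorem iSup_eq_iSup_rat {g : ℝ → ℝ} (hg : ∀ y, ContinuousWithinAt g (Ici y) y)
    (hb : BddAbove (range g)) : ⨆ y, g y = ⨆ q : ℚ, g q := by
  have hbq : BddAbove (range fun q : ℚ => g q) := by
    refine hb.mono ?_
    rintro _ ⟨q, rfl⟩
    exact ⟨q, rfl⟩
  refine le_antisymm (ciSup_le fun y => ?_) (ciSup_le fun q => le_ciSup hb (q : ℝ))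
  by_contra! hlt
  obtain ⟨b, hyb, hsub⟩ := (mem_nhdsGE_iff_exists_Ico_subset).mp
    ((hg y).eventually (lt_mem_nhds hlt))
  obtain ⟨q, hq1, hq2⟩ := exists_rat_btwn (mem_Ioi.mp hyb)
  exact absurd (le_ciSup hbq q) (not_le.mpr (hsub ⟨hq1.le, hq2⟩))

/-- Only countably many null sets, one per rational threshold, are discarded; right-continuity
covers the remaining thresholds. -/
theorem IsRadonInverseFamily.ae_eq {g : ℝ → Sph n → ℝ → ℝ} {F F' : ℝ → Euc (n + 1) → ℝ}
    (h : IsRadonInverseFamily g F) (h' : IsRadonInverseFamily g F') :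
    ∀ᵐ γ, ∀ y, F y γ = F' y γ := by
  have hq : ∀ᵐ γ, ∀ q : ℚ, F q γ = F' q γ :=
    ae_all_iff.mpr fun q => (h.1 q).ae_eq (h'.1 q)
  filter_upwards [hq] with γ hγ y
  exact sub_eq_zero.mp (eq_zero_of_rightContinuous (g := fun t => F t γ - F' t γ)
    (fun t => (h.2 γ t).sub (h'.2 γ t)) (fun q => sub_eq_zero.mpr (hγ q)) y)

theorem radonInvFamily_ae_eq {g : ℝ → Sph n → ℝ → ℝ} {F : ℝ → Euc (n + 1) → ℝ}
    (h : IsRadonInverseFamily g F) : ∀ᵐ γ, ∀ y, radonInvFamily g y γ = F y γ := by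
  have hex : ∃ F, IsRadonInverseFamily g F := ⟨F, h⟩
  rw [radonInvFamily, dif_pos hex]
  exact hex.choose_spec.ae_eq h

/-- The function `1{t ≤ y}` of `t`. -/
def below (y t : ℝ) : ℝ := if t ≤ y then 1 else 0

theorem measurable_below (y : ℝ) : Measurable (below y) :=
  Measurable.ite measurableSet_Iic measurable_const measurable_const

theorem below_nonneg (y t : ℝ) : 0 ≤ below y t := by unfold below; split_ifs <;> norm_num

theorem below_le_one (y t : ℝ) : below y t ≤ 1 := by unfold below; split_ifs <;> norm_num

theorem integrable_below {α : Type*} [MeasurableSpace α] {μ : Measure α} [IsFiniteMeasure μ]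
    {c : α → ℝ} (hc : Measurable c) (y : ℝ) : Integrable (fun p => below y (c p)) μ := by
  refine (integrable_const (1 : ℝ)).mono ((measurable_below y).comp hc).aestronglyMeasurable
    (.of_forall fun p => ?_)
  rw [Real.norm_of_nonneg (below_nonneg _ _), norm_one]
  exact below_le_one _ _

theorem integral_below {α : Type*} [MeasurableSpace α] {μ : Measure α} [IsFiniteMeasure μ]
    {c : α → ℝ} (hc : Measurable c) (y : ℝ) : ∫ p, below y (c p) ∂μ = μ.real {p | c p ≤ y} := by
  have hm : MeasurableSet {p | c p ≤ y} := hc measurableSet_Iic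
  rw [← integral_indicator_one hm]
  refine integral_congr_ae (.of_forall fun p => ?_)
  simp [below, indicator]

theorem continuousWithinAt_below (y t : ℝ) :
    ContinuousWithinAt (fun y => below y t) (Ici y) y := by
  by_cases h : t ≤ y
  · exact (continuousWithinAt_const (b := (1 : ℝ))).congr
      (fun z hz => if_pos (h.trans (mem_Ici.mp hz))) (if_pos h)
  · refine ContinuousAt.continuousWithinAt ((continuousAt_const (y := (0 : ℝ))).congr ?_)
    filter_upwards [gt_mem_nhds (not_le.mp h)] with z hz
    exact (if_neg (not_le.mpr hz)).symm

theorem continuousWithinAt_weightedDensity_below (ν : Measure (Pop n)) [IsFiniteMeasure ν]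
    {c : ℝ × ℝ → ℝ} (hc : Measurable c) (γ : Euc (n + 1)) (y : ℝ) :
    ContinuousWithinAt (fun y => weightedDensity ν (fun p => below y (c p)) γ) (Ici y) y := by
  refine continuousWithinAt_const.mul ?_
  refine continuousWithinAt_of_dominated (bound := fun _ => 1)
    (.of_forall fun z => (integrable_below hc z).aestronglyMeasurable)
    (.of_forall fun z => .of_forall fun p => ?_) (integrable_const _)
    (.of_forall fun p => continuousWithinAt_below y (c p))
  rw [Real.norm_of_nonneg (below_nonneg _ _)]
  exact below_le_one _ _

/-! ### The observed variables in terms of the potential outcomes -/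

theorem treat_eq_zero_or_one (w : Pop n) : treat w = 0 ∨ treat w = 1 := by
  unfold treat; split_ifs <;> simp

theorem treatedBelow_eq (y : ℝ) (w : Pop n) :
    treatedBelow y w = treat w * below y (y1 w) + (1 - treat w) * 0 := by
  rcases treat_eq_zero_or_one w with h | h <;> simp [treatedBelow, below, outcome, effect, h]

theorem untreatedBelow_eq (y : ℝ) (w : Pop n) :
    untreatedBelow y w = treat w * 0 + (1 - treat w) * -below y (y0 w) := by
  rcases treat_eq_zero_or_one w with h | h <;> simp [untreatedBelow, below, outcome, effect, h]

theorem jointBelow_eq (a0 a1 : ℝ) (w : Pop n) :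
    jointBelow a0 a1 w = treat w * below a1 (y1 w) + (1 - treat w) * -below a0 (y0 w) := by
  rcases treat_eq_zero_or_one w with h | h
  · simp [jointBelow, below, outcome, effect, h]
  · simp [jointBelow, below, outcome, effect, h]; norm_num

theorem measurable_effect : Measurable (effect : Pop n → ℝ) :=
  measurable_y1.sub measurable_y0

section

variable {ν : Measure (Pop n)} [IsProbabilityMeasure ν]

/-! ### Bounds on the joint distribution -/

theorem Regular.treatedBelow (h : Regular ν) (y : ℝ) :
    Identified ν (treatedBelow y) ∧ ∫ γ, ident ν (RandCoef.treatedBelow y) γ =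
      ν.real {w | y1 w ≤ y} := by
  have := h.identified (measurable_below y) (measurable_const (a := (0 : ℝ)))
    (integrable_below measurable_y1 y) (integrable_const 0) (treatedBelow_eq y)
  simpa [integral_below measurable_y1] using this

theorem Regular.untreatedBelow (h : Regular ν) (y : ℝ) :
    Identified ν (untreatedBelow y) ∧ ∫ γ, ident ν (RandCoef.untreatedBelow y) γ =
      ν.real {w | y0 w ≤ y} := by
  have := h.identified (measurable_const (a := (0 : ℝ))) (measurable_below y).neg
    (integrable_const 0) (integrable_below measurable_y0 y).neg (untreatedBelow_eq y)
  simpa [integral_neg, integral_below measurable_y0] using this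

theorem Regular.jointBelow (h : Regular ν) (a0 a1 : ℝ) :
    Identified ν (jointBelow a0 a1) ∧ ∫ γ, ident ν (RandCoef.jointBelow a0 a1) γ =
      ν.real {w | y1 w ≤ a1} + ν.real {w | y0 w ≤ a0} := by
  have := h.identified (measurable_below a1) (measurable_below a0).neg
    (integrable_below measurable_y1 a1) (integrable_below measurable_y0 a0).neg
    (jointBelow_eq a0 a1)
  simpa [integral_neg, integral_below measurable_y0, integral_below measurable_y1] using this

/-- Inclusion–exclusion, with the probability of the union bounded by `1`. -/
theorem Regular.jointLower_le (h : Regular ν) (a0 a1 : ℝ) :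
    jointLower ν a0 a1 ≤ ν.real {w | y0 w ≤ a0 ∧ y1 w ≤ a1} := by
  rw [jointLower, (h.jointBelow a0 a1).2]
  refine max_le ?_ measureReal_nonneg
  have hm : MeasurableSet {w : Pop n | y1 w ≤ a1} := measurable_y1 measurableSet_Iic
  have h1 := measureReal_union_add_inter (μ := ν) (s := {w | y0 w ≤ a0}) hm
  have h2 : ν.real ({w | y0 w ≤ a0} ∪ {w | y1 w ≤ a1}) ≤ 1 := measureReal_le_one
  have h3 : ({w | y0 w ≤ a0} ∩ {w | y1 w ≤ a1} : Set (Pop n)) = {w | y0 w ≤ a0 ∧ y1 w ≤ a1} := rfl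
  rw [h3] at h1
  linarith

theorem Regular.le_jointUpper (h : Regular ν) (a0 a1 : ℝ) :
    ν.real {w | y0 w ≤ a0 ∧ y1 w ≤ a1} ≤ jointUpper ν a0 a1 := by
  rw [jointUpper, (h.untreatedBelow a0).2, (h.treatedBelow a1).2]
  exact le_min (measureReal_mono fun w hw => hw.1) (measureReal_mono fun w hw => hw.2)

/-! ### Bounds on the distribution of the treatment effect -/

theorem Regular.family_treated (h : Regular ν) :
    IsRadonInverseFamily (fun y => dReg ν (RandCoef.treatedBelow y))
      fun y => weightedDensity ν fun p => below y p.2 := by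
  refine ⟨fun y => ?_, fun γ y => continuousWithinAt_weightedDensity_below ν measurable_snd γ y⟩
  have := (h.identification (measurable_below y) (measurable_const (a := (0 : ℝ)))
    (integrable_below measurable_y1 y) (integrable_const 0) (treatedBelow_eq y)).2
  simpa only [sub_zero] using this

theorem Regular.family_untreated (h : Regular ν) :
    IsRadonInverseFamily (fun y => dReg ν (RandCoef.untreatedBelow y))
      fun y => weightedDensity ν fun p => below y p.1 := by
  refine ⟨fun y => ?_, fun γ y => continuousWithinAt_weightedDensity_below ν measurable_fst γ y⟩
  have := (h.identification (measurable_const (a := (0 : ℝ))) (measurable_below y).neg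
    (integrable_const 0) (integrable_below measurable_y0 y).neg (untreatedBelow_eq y)).2
  simpa only [Pi.neg_apply, zero_sub, neg_neg] using this

/-- The difference of the conditional distribution functions, weighted by the density of `Γ̃`. -/
def cdfGap (ν : Measure (Pop n)) [IsFiniteMeasure ν] (δ y : ℝ) (γ : Euc (n + 1)) : ℝ :=
  weightedDensity ν (fun p => below y p.2) γ - weightedDensity ν (fun p => below (y - δ) p.1) γ

theorem measurable_cdfGap (δ y : ℝ) : Measurable (cdfGap ν δ y) :=
  (stronglyMeasurable_weightedDensity
    ((measurable_below y).comp measurable_snd)).measurable.sub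
  (stronglyMeasurable_weightedDensity
    ((measurable_below (y - δ)).comp measurable_fst)).measurable

theorem continuousWithinAt_cdfGap (δ y : ℝ) (γ : Euc (n + 1)) :
    ContinuousWithinAt (fun t => cdfGap ν δ t γ) (Ici y) y := by
  refine (continuousWithinAt_weightedDensity_below ν measurable_snd γ y).sub ?_
  refine (continuousWithinAt_weightedDensity_below ν measurable_fst γ (y - δ)).comp
    (f := fun t => t - δ) (by fun_prop) fun t ht => ?_
  simpa using ht

theorem cdfGap_eq (δ y : ℝ) (γ : Euc (n + 1)) :
    cdfGap ν δ y γ = weightedDensity ν (fun p => below y p.2 - below (y - δ) p.1) γ := by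
  rw [cdfGap, weightedDensity, weightedDensity, weightedDensity,
    integral_sub (integrable_below measurable_snd _) (integrable_below measurable_fst _), mul_sub]

/-- Makarov's inequality given `Γ̃ = γ`: if `Y₁ ≤ y` and `Y₀ > y - δ`, then `Δ ≤ δ`. -/
theorem cdfGap_le (δ y : ℝ) (γ : Euc (n + 1)) :
    cdfGap ν δ y γ ≤ weightedDensity ν (fun p => below δ (p.2 - p.1)) γ := by
  rw [cdfGap_eq]
  refine mul_le_mul_of_nonneg_left (integral_mono
    ((integrable_below measurable_snd _).sub (integrable_below measurable_fst _))
    (integrable_below (by fun_prop) _) fun p => ?_) (latentDensity_nonneg ν γ)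
  simp only [below]
  split_ifs <;> linarith

/-- The opposite inequality: if `Y₁ > y` and `Y₀ ≤ y - δ`, then `Δ > δ`. -/
theorem le_cdfGap (δ y : ℝ) (γ : Euc (n + 1)) :
    weightedDensity ν (fun p => below δ (p.2 - p.1) - 1) γ ≤ cdfGap ν δ y γ := by
  rw [cdfGap_eq]
  refine mul_le_mul_of_nonneg_left (integral_mono
    ((integrable_below (by fun_prop) _).sub (integrable_const _))
    ((integrable_below measurable_snd _).sub (integrable_below measurable_fst _))
    fun p => ?_) (latentDensity_nonneg ν γ)
  simp only [below]
  split_ifs <;> linarith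

theorem weightedDensity_effect_nonneg (δ : ℝ) (γ : Euc (n + 1)) :
    0 ≤ weightedDensity ν (fun p => below δ (p.2 - p.1)) γ :=
  mul_nonneg (latentDensity_nonneg ν γ) (integral_nonneg fun _ => below_nonneg _ _)

theorem weightedDensity_effect_nonpos (δ : ℝ) (γ : Euc (n + 1)) :
    weightedDensity ν (fun p => below δ (p.2 - p.1) - 1) γ ≤ 0 :=
  mul_nonpos_of_nonneg_of_nonpos (latentDensity_nonneg ν γ)
    (integral_nonpos fun _ => sub_nonpos.mpr (below_le_one _ _))

theorem Regular.ae_gap (h : Regular ν) (δ : ℝ) :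
    ∀ᵐ γ, ∀ y, identFamily ν RandCoef.treatedBelow y γ -
      identFamily ν RandCoef.untreatedBelow (y - δ) γ = cdfGap ν δ y γ := by
  filter_upwards [radonInvFamily_ae_eq h.family_treated,
    radonInvFamily_ae_eq h.family_untreated] with γ h1 h0 y
  rw [identFamily, identFamily, h1, h0, cdfGap]

theorem Regular.ae_effectLowerAt (h : Regular ν) (δ : ℝ) :
    ∀ᵐ γ, effectLowerAt ν δ γ = ⨆ q : ℚ, max (cdfGap ν δ q γ) 0 := by
  filter_upwards [h.ae_gap δ] with γ hγ
  simp only [effectLowerAt, hγ]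
  refine iSup_eq_iSup_rat (g := fun y => max (cdfGap ν δ y γ) 0)
    (fun y => (continuousWithinAt_cdfGap δ y γ).max continuousWithinAt_const)
    ⟨weightedDensity ν (fun p => below δ (p.2 - p.1)) γ, ?_⟩
  rintro _ ⟨y, rfl⟩
  exact max_le (cdfGap_le δ y γ) (weightedDensity_effect_nonneg δ γ)

theorem Regular.ae_effectUpperAt (h : Regular ν) (δ : ℝ) :
    ∀ᵐ γ, effectUpperAt ν δ γ = -⨆ q : ℚ, max (-cdfGap ν δ q γ) 0 := by
  filter_upwards [h.ae_gap δ] with γ hγ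
  have hmin (y : ℝ) : min (cdfGap ν δ y γ) 0 = -max (-cdfGap ν δ y γ) 0 := by
    rw [← neg_inj, neg_neg, ← max_neg_neg, neg_zero]
  simp only [effectUpperAt, hγ, hmin]
  rw [← iSup_eq_iSup_rat (g := fun y => max (-cdfGap ν δ y γ) 0)
    (fun y => (continuousWithinAt_cdfGap δ y γ).neg.max continuousWithinAt_const)
    ⟨-weightedDensity ν (fun p => below δ (p.2 - p.1) - 1) γ, ?_⟩]
  -- The real infimum is by definition minus the supremum of the negated set.
  · rw [iInf, Real.sInf_def, iSup]
    congr 2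
    ext t
    simp [neg_eq_iff_eq_neg]
  · rintro _ ⟨y, rfl⟩
    exact max_le (neg_le_neg (le_cdfGap δ y γ))
      (neg_nonneg.mpr (weightedDensity_effect_nonpos δ γ))

theorem Regular.effectLowerAt_bounds (h : Regular ν) (δ : ℝ) :
    ∀ᵐ γ, 0 ≤ effectLowerAt ν δ γ ∧
      effectLowerAt ν δ γ ≤ weightedDensity ν (fun p => below δ (p.2 - p.1)) γ := by
  filter_upwards [h.ae_gap δ] with γ hγ
  simp only [effectLowerAt, hγ]
  exact ⟨Real.iSup_nonneg fun y => le_max_right _ _,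
    ciSup_le fun y => max_le (cdfGap_le δ y γ) (weightedDensity_effect_nonneg δ γ)⟩

theorem Regular.effectUpperAt_bounds (h : Regular ν) (δ : ℝ) :
    ∀ᵐ γ, weightedDensity ν (fun p => below δ (p.2 - p.1) - 1) γ ≤ effectUpperAt ν δ γ ∧
      effectUpperAt ν δ γ ≤ 0 := by
  filter_upwards [h.ae_gap δ] with γ hγ
  simp only [effectUpperAt, hγ]
  exact ⟨le_ciInf fun y => le_min (le_cdfGap δ y γ) (weightedDensity_effect_nonpos δ γ),
    Real.iInf_nonpos fun y => min_le_right _ _⟩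

theorem Regular.integrable_effect (h : Regular ν) (δ : ℝ) :
    Integrable (weightedDensity ν fun p => below δ (p.2 - p.1)) ∧
    ∫ γ, weightedDensity ν (fun p => below δ (p.2 - p.1)) γ = ν.real {w | effect w ≤ δ} := by
  have hm : Measurable fun p : ℝ × ℝ => below δ (p.2 - p.1) :=
    (measurable_below δ).comp (by fun_prop)
  have hi : Integrable (fun w : Pop n => below δ (y1 w - y0 w)) ν :=
    integrable_below measurable_effect δ
  refine ⟨integrable_weightedDensity h.absCont.map_tG hm hi, ?_⟩
  rw [integral_weightedDensity h.absCont.map_tG hm hi]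
  exact integral_below measurable_effect δ

theorem Regular.integrable_effect_sub_one (h : Regular ν) (δ : ℝ) :
    Integrable (weightedDensity ν fun p => below δ (p.2 - p.1) - 1) ∧
    ∫ γ, weightedDensity ν (fun p => below δ (p.2 - p.1) - 1) γ =
      ν.real {w | effect w ≤ δ} - 1 := by
  have hm : Measurable fun p : ℝ × ℝ => below δ (p.2 - p.1) - 1 :=
    ((measurable_below δ).comp (by fun_prop)).sub_const 1
  have hi' : Integrable (fun w : Pop n => below δ (y1 w - y0 w)) ν :=
    integrable_below measurable_effect δ
  have hi : Integrable (fun w : Pop n => below δ (y1 w - y0 w) - 1) ν :=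
    hi'.sub (integrable_const _)
  refine ⟨integrable_weightedDensity h.absCont.map_tG hm hi, ?_⟩
  rw [integral_weightedDensity h.absCont.map_tG hm hi, integral_sub hi' (integrable_const _)]
  have := integral_below (μ := ν) measurable_effect δ
  simp only [effect] at this ⊢
  rw [this]
  simp

theorem Regular.integrable_effectLowerAt (h : Regular ν) (δ : ℝ) :
    Integrable (effectLowerAt ν δ) := by
  refine (h.integrable_effect δ).1.mono ?_ ?_
  · refine AEMeasurable.aestronglyMeasurable ⟨_, ?_, h.ae_effectLowerAt δ⟩
    exact Measurable.iSup fun q : ℚ => (measurable_cdfGap δ q).max measurable_const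
  · filter_upwards [h.effectLowerAt_bounds δ] with γ hγ
    rw [Real.norm_of_nonneg hγ.1, Real.norm_of_nonneg (hγ.1.trans hγ.2)]
    exact hγ.2

theorem Regular.integrable_effectUpperAt (h : Regular ν) (δ : ℝ) :
    Integrable (effectUpperAt ν δ) := by
  refine (h.integrable_effect_sub_one δ).1.mono ?_ ?_
  · refine AEMeasurable.aestronglyMeasurable ⟨_, ?_, h.ae_effectUpperAt δ⟩
    exact (Measurable.iSup fun q : ℚ => (measurable_cdfGap δ q).neg.max measurable_const).neg
  · filter_upwards [h.effectUpperAt_bounds δ] with γ hγ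
    rw [Real.norm_of_nonpos hγ.2, Real.norm_of_nonpos (hγ.1.trans hγ.2)]
    exact neg_le_neg hγ.1

theorem Regular.effectLower_le (h : Regular ν) (δ : ℝ) :
    effectLower ν δ ≤ ν.real {w | effect w ≤ δ} := by
  rw [effectLower, ← (h.integrable_effect δ).2]
  exact integral_mono_ae (h.integrable_effectLowerAt δ) (h.integrable_effect δ).1
    ((h.effectLowerAt_bounds δ).mono fun _ hγ => hγ.2)

theorem Regular.le_effectUpper (h : Regular ν) (δ : ℝ) :
    ν.real {w | effect w ≤ δ} ≤ effectUpper ν δ := by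
  have := integral_mono_ae (h.integrable_effect_sub_one δ).1 (h.integrable_effectUpperAt δ)
    ((h.effectUpperAt_bounds δ).mono fun _ hγ => hγ.1)
  rw [(h.integrable_effect_sub_one δ).2] at this
  rw [effectUpper]
  linarith

/-! ### Bounds on the variance of the treatment effect -/

/-- The quadratic `t ↦ ∫ (t f + g)²` is nonnegative, so its discriminant is at most `0`. -/
theorem sq_integral_mul_le {α : Type*} [MeasurableSpace α] {μ : Measure α} {f g : α → ℝ}
    (hf : MemLp f 2 μ) (hg : MemLp g 2 μ) :
    (∫ x, f x * g x ∂μ) ^ 2 ≤ (∫ x, f x ^ 2 ∂μ) * ∫ x, g x ^ 2 ∂μ := by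
  have hfg : Integrable (fun x => f x * g x) μ := hf.integrable_mul hg
  have key (t : ℝ) : 0 ≤ (∫ x, f x ^ 2 ∂μ) * (t * t) + (2 * ∫ x, f x * g x ∂μ) * t
      + ∫ x, g x ^ 2 ∂μ := by
    have e : ∫ x, (t * f x + g x) ^ 2 ∂μ = (∫ x, f x ^ 2 ∂μ) * (t * t)
        + (2 * ∫ x, f x * g x ∂μ) * t + ∫ x, g x ^ 2 ∂μ := by
      have : (fun x => (t * f x + g x) ^ 2) =
          fun x => t * t * f x ^ 2 + 2 * t * (f x * g x) + g x ^ 2 := by ext x; ring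
      have hi : Integrable (fun x => t * t * f x ^ 2 + 2 * t * (f x * g x)) μ :=
        (hf.integrable_sq.const_mul _).add (hfg.const_mul _)
      rw [this, integral_add hi hg.integrable_sq,
        integral_add (hf.integrable_sq.const_mul _) (hfg.const_mul _),
        integral_const_mul, integral_const_mul]
      ring
    rw [← e]
    exact integral_nonneg fun x => sq_nonneg _
  have := discrim_le_zero key
  rw [discrim] at this
  nlinarith

theorem outcome_eq (w : Pop n) : outcome w = treat w * y1 w + (1 - treat w) * y0 w := by
  rw [outcome, effect]; ring

/-- The identified terms are `E Δ`, `-E Y₁² - E Y₀²`, `E Y₀²` and `E Y₁²`. The bracket on the left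
is thus `-2 E[Y₀ Y₁]`, and the claim is Cauchy–Schwarz. -/
theorem Regular.variance_bound (h : Regular ν) (h0 : MemLp y0 2 ν) (h1 : MemLp y1 2 ν) :
    (MemLp effect 2 ν ∧
      Identified ν outcome ∧
      Identified ν (fun w => (1 - 2 * treat w) * outcome w ^ 2) ∧
      Identified ν (fun w => (treat w - 1) * outcome w ^ 2) ∧
      Identified ν (fun w => treat w * outcome w ^ 2)) ∧
    (Var[effect; ν] + (∫ γ, ident ν outcome γ) ^ 2
        + ∫ γ, ident ν (fun w => (1 - 2 * treat w) * outcome w ^ 2) γ) ^ 2 ≤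
      4 * (∫ γ, ident ν (fun w => (treat w - 1) * outcome w ^ 2) γ)
        * ∫ γ, ident ν (fun w => treat w * outcome w ^ 2) γ := by
  have i0 := h0.integrable (by norm_num)
  have i1 := h1.integrable (by norm_num)
  have s0 := h0.integrable_sq
  have s1 := h1.integrable_sq
  have hsq : Measurable fun t : ℝ => t ^ 2 := by fun_prop
  have k1 := h.identified measurable_id measurable_id i1 i0 outcome_eq
  have k2 := h.identified (W := fun w => (1 - 2 * treat w) * outcome w ^ 2) hsq.neg hsq s1.neg s0
    (fun w => by
      rcases treat_eq_zero_or_one w with h | h <;>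
        simp only [outcome_eq, h, Pi.neg_apply] <;> ring)
  have k3 := h.identified (W := fun w => (treat w - 1) * outcome w ^ 2)
    (measurable_const (a := (0 : ℝ))) hsq.neg (integrable_const 0) s0.neg (fun w => by
      rcases treat_eq_zero_or_one w with h | h <;>
        simp only [outcome_eq, h, Pi.neg_apply] <;> ring)
  have k4 := h.identified (W := fun w => treat w * outcome w ^ 2) hsq
    (measurable_const (a := (0 : ℝ))) s1 (integrable_const 0) (fun w => by
      rcases treat_eq_zero_or_one w with h | h <;> simp only [outcome_eq, h] <;> ring)
  have hE : MemLp effect 2 ν := h1.sub h0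
  refine ⟨⟨hE, k1.1, k2.1, k3.1, k4.1⟩, ?_⟩
  have h01 : Integrable (fun w => y0 w * y1 w) ν := h0.integrable_mul h1
  have hmean : ∫ w, effect w ∂ν = (∫ w, y1 w ∂ν) - ∫ w, y0 w ∂ν := integral_sub i1 i0
  have hsecond : ∫ w, effect w ^ 2 ∂ν =
      (∫ w, y1 w ^ 2 ∂ν) - 2 * (∫ w, y0 w * y1 w ∂ν) + ∫ w, y0 w ^ 2 ∂ν := by
    have : (fun w : Pop n => effect w ^ 2) =
        fun w => y1 w ^ 2 - 2 * (y0 w * y1 w) + y0 w ^ 2 := by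
      ext w; rw [effect]; ring
    have hi : Integrable (fun w => y1 w ^ 2 - 2 * (y0 w * y1 w)) ν := s1.sub (h01.const_mul _)
    rw [this, integral_add hi s0, integral_sub s1 (h01.const_mul _),
      integral_const_mul]
  have hvar := variance_eq_sub hE
  have hsecond' : ν[effect ^ 2] = ∫ w, effect w ^ 2 ∂ν := rfl
  rw [hsecond', hsecond, hmean] at hvar
  rw [k1.2, k2.2, k3.2, k4.2, hvar]
  simp only [Pi.neg_apply, integral_neg, integral_zero, id_eq]
  have hcs := sq_integral_mul_le h0 h1
  nlinarith

end

end

end RandCoef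

/-! ### From a single conditional law to almost every `x` -/

open RandCoef in
theorem theorem3 {Ω : Type*} [MeasurableSpace Ω] (P : Measure Ω) [IsProbabilityMeasure P]
    (n k : ℕ)
    -- potential outcomes, instruments, first-stage coefficients; here `L = n + 1`
    (Y0 Y1 V : Ω → ℝ) (Z Γ : Ω → Euc n) (Θ : Ω → ℝ)
    (hY0 : Measurable Y0) (hY1 : Measurable Y1) (hV : Measurable V)
    (hZ : Measurable Z) (hΓ : Measurable Γ) (hΘ : Measurable Θ)
    -- covariates: potential values `X₀`, `X₁`, and the observed value `X`
    (X0 X1 X : Ω → Euc k) (hX0 : Measurable X0) (hX1 : Measurable X1)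
    (hX : ∀ ω, X ω = if treat (pop Y0 Y1 V Z Γ Θ ω) = 1 then X1 ω else X0 ω)
    -- `κ x` is the conditional distribution of `(Y₀, Y₁, V, Z, Γ, Θ)` given `X = x`
    (κ : Kernel (Euc k) (Pop n)) [IsMarkovKernel κ]
    (hκ : κ = condDistrib (pop Y0 Y1 V Z Γ Θ) X P)
    -- the assumptions
    (hAC : ∀ᵐ x ∂(P.map X), AbsCont (κ x))
    (hExo : ∀ᵐ x ∂(P.map X), Exogenous (κ x))
    (hOverlap : ∀ᵐ x ∂(P.map X), Overlap (κ x))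
    (hXX : X0 =ᵐ[P] X1)
    (hSupp : ∀ᵐ x ∂(P.map X), LargeSupport (κ x)) :
    (∀ᵐ x ∂(P.map X),
      -- the identified quantities in the bounds are well defined
      ((∀ a0 a1 : ℝ, Identified (κ x) (jointBelow a0 a1)) ∧
        (∀ a : ℝ, Identified (κ x) (treatedBelow a) ∧ Identified (κ x) (untreatedBelow a)) ∧
        IdentifiedFamily (κ x) treatedBelow ∧ IdentifiedFamily (κ x) untreatedBelow ∧
        ∀ δ : ℝ, Integrable (effectLowerAt (κ x) δ) ∧ Integrable (effectUpperAt (κ x) δ)) ∧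
      -- the bounds
      ∀ a0 a1 δ : ℝ,
        (jointLower (κ x) a0 a1 ≤ (κ x).real {w | y0 w ≤ a0 ∧ y1 w ≤ a1} ∧
          (κ x).real {w | y0 w ≤ a0 ∧ y1 w ≤ a1} ≤ jointUpper (κ x) a0 a1) ∧
        (effectLower (κ x) δ ≤ (κ x).real {w | effect w ≤ δ} ∧
          (κ x).real {w | effect w ≤ δ} ≤ effectUpper (κ x) δ)) ∧
    (Integrable (fun ω => Y0 ω ^ 2 + Y1 ω ^ 2) P →
      ∀ᵐ x ∂(P.map X),
        (MemLp effect 2 (κ x) ∧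
          Identified (κ x) outcome ∧
          Identified (κ x) (fun w => (1 - 2 * treat w) * outcome w ^ 2) ∧
          Identified (κ x) (fun w => (treat w - 1) * outcome w ^ 2) ∧
          Identified (κ x) (fun w => treat w * outcome w ^ 2)) ∧
        (Var[effect; κ x] + (∫ γ, ident (κ x) outcome γ) ^ 2
            + ∫ γ, ident (κ x) (fun w => (1 - 2 * treat w) * outcome w ^ 2) γ) ^ 2 ≤
          4 * (∫ γ, ident (κ x) (fun w => (treat w - 1) * outcome w ^ 2) γ)
            * ∫ γ, ident (κ x) (fun w => treat w * outcome w ^ 2) γ) := by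
  have hAll : ∀ᵐ x ∂(P.map X), Regular (κ x) := by
    filter_upwards [hAC, hExo, hSupp] with x h1 h2 h3
    exact ⟨h1, h2, h3⟩
  refine ⟨?_, fun hI => ?_⟩
  · filter_upwards [hAll] with x hx
    exact ⟨⟨fun a0 a1 => (hx.jointBelow a0 a1).1,
        fun a => ⟨(hx.treatedBelow a).1, (hx.untreatedBelow a).1⟩,
        ⟨fun y => (hx.treatedBelow y).1.1, _, hx.family_treated⟩,
        ⟨fun y => (hx.untreatedBelow y).1.1, _, hx.family_untreated⟩,
        fun δ => ⟨hx.integrable_effectLowerAt δ, hx.integrable_effectUpperAt δ⟩⟩,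
      fun a0 a1 δ => ⟨⟨hx.jointLower_le a0 a1, hx.le_jointUpper a0 a1⟩,
        hx.effectLower_le δ, hx.le_effectUpper δ⟩⟩
  · have hpop : Measurable (pop Y0 Y1 V Z Γ Θ) := by
      unfold pop
      fun_prop
    have hXm : Measurable X := by
      rw [show X = _ from funext hX]
      exact Measurable.ite ((measurable_treat.comp hpop) (measurableSet_singleton 1)) hX1 hX0
    have hmeas : Measurable fun w : Pop n => y0 w ^ 2 + y1 w ^ 2 :=
      (measurable_y0.pow_const 2).add (measurable_y1.pow_const 2)
    have hmap : Integrable (fun q : Euc k × Pop n => y0 q.2 ^ 2 + y1 q.2 ^ 2)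
        (P.map fun ω => (X ω, pop Y0 Y1 V Z Γ Θ ω)) := by
      exact (integrable_map_measure (hmeas.comp measurable_snd).aestronglyMeasurable
        (hXm.prodMk hpop).aemeasurable).mpr hI
    -- Integrability under the joint law of `X` and the population vector passes to almost every
    -- conditional law, giving finite conditional second moments.
    have hmom := hmap.condDistrib_ae_map hpop.aemeasurable
    rw [← hκ] at hmom
    filter_upwards [hAll, hmom] with x hx hm
    refine hx.variance_bound ((memLp_two_iff_integrable_sq measurable_y0.aestronglyMeasurable).mpr ?_)
      ((memLp_two_iff_integrable_sq measurable_y1.aestronglyMeasurable).mpr ?_)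
    · refine hm.mono (measurable_y0.pow_const 2).aestronglyMeasurable (.of_forall fun w => ?_)
      rw [Real.norm_of_nonneg (sq_nonneg _), Real.norm_of_nonneg (by positivity)]
      exact le_add_of_nonneg_right (sq_nonneg _)
    · refine hm.mono (measurable_y1.pow_const 2).aestronglyMeasurable (.of_forall fun w => ?_)
      rw [Real.norm_of_nonneg (sq_nonneg _), Real.norm_of_nonneg (by positivity)]
      exact le_add_of_nonneg_left (sq_nonneg _)
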